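/- **Proposition (Wigner–Moyal transport equation).** Let $\lambda>0$, $k=2\pi/\lambda$ and $ƛ=\lambda/2\pi=1/k$. Let $n:\mathbb R^2\to\mathbb R$ be a smooth refractive index which, with all its derivatives, grows at most polynomially, and let $Z\subset\mathbb R$ be open. Let $U=U_\omega(r,z)$, $r\in\mathbb R^2$, $z\in Z$, be a random (possibly deterministic) field, measurable in $\omega$, such that each $U_\omega(\cdot,z)$ is a Schwartz function and each Schwartz seminorm of $U_\omega(\cdot,z)$ is, locally uniformly in $z$, bounded by a square-integrable random variable. Let $$\mathcal W_z(r,q)=\frac1{(2\pi)^2}\int_{\mathbb R^2}\Big\langle U^*\big(r-\tfrac{\Delta}{2},z\big)\,U\big(r+\tfrac{\Delta}{2},z\big)\Big\rangle e^{-iq\cdot\Delta}\,d^2\Delta$$ be its Wigner function, where $\langle\cdot\rangle$ is the ensemble average and $q$ the spatial frequency. For phase space functions $A,B$ let $$\{\{A,B\}\}=\frac{2}{ƛ}\sin\!\Big(\frac{ƛ}{2}\Lambda\Big)(A,B),\qquad \Lambda(A,B)=\{A,B\}_{\mathrm{PB}}=\partial_rA\cdot\partial_pB-\partial_pA\cdot\partial_rB,$$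 be the Moyal bracket. Here $\sin(\tau\Lambda)=\frac1{2i}(e^{i\tau\Lambda}-e^{-i\tau\Lambda})$, and $e^{i\tau\Lambda}$ is given on plane waves by $e^{i\tau\Lambda}(A,B)(r,p)=A(r-\tau d,\,p+\tau c)\,B(r,p)$ for $B(r,p)=e^{i(c\cdot r+d\cdot p)}$, and in general by Fourier superposition in $B$. Then all the integrals that define $\mathcal W_z$ and the brackets below converge absolutely, and the following holds. 1. Let $\sigma\in\{1,-1\}$. If almost every realization satisfies the paraxial wave equation $$2ik\,\frac{\partial U}{\partial z}=\sigma\big(\nabla_\perp^2U+k^2(n^2(r)-1)U\big)\qquad(r\in\mathbb R^2,\ z\in Z),$$ ($\sigma=1$ for the carrier $e^{-ikz}$, $\sigma=-1$ for the carrier $e^{ikz}$), then $w_z(r,p)=\mathcal W_z(r,-\sigma kp)$, as a function of position and the dimensionless optical momentum $p$, satisfies $$\frac{\partial w}{\partial z}=\{\{\mathcal H,w\}\},\qquad \mathcal H(r,p)=\frac{|p|^2}{2}-\frac{n^2(r)-1}{2},$$ for all $r,p\in\mathbb R^2$ and $z\in Z$. 2. Suppose that $n>0$ and that $1/n$, with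 all its derivatives, grows at most polynomially. If almost every realization satisfies $iƛ\,\partial U/\partial z=\hat HU$, where $\hat H$ is the Weyl quantization, with parameter $ƛ$ in place of $\hbar$, of the optical Hamiltonian $$\mathcal H(r,p)=-n(r)+\frac{|p|^2}{2n(r)},$$ then $w_z(r,p)=\mathcal W_z(r,kp)$ satisfies $\partial w/\partial z=\{\{\mathcal H,w\}\}$ for all $r,p\in\mathbb R^2$ and $z\in Z$. -/

import Mathlib

open MeasureTheory Complex
open scoped ComplexConjugate SchwartzMap RealInnerProductSpace

noncomputable section

namespace WignerOptics

/-- The transverse plane. -/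
abbrev Plane : Type := EuclideanSpace ℝ (Fin 2)

/-- The four-dimensional phase space of pairs `(r, p)`. -/
abbrev PhaseSpace : Type := Plane × Plane

/-- The wavenumber `k = 2π / λ`. -/
def wavenumber (lam : ℝ) : ℝ := 2 * Real.pi / lam

/-- The reduced wavelength `λ / 2π`. -/
def reducedWavelength (lam : ℝ) : ℝ := lam / (2 * Real.pi)

/-! ### Fields, cross-spectral density and Wigner function -/

/-- The cross-spectral density `⟨U*(r₁) U(r₂)⟩` of a random field `U`. -/
def csd {Ω : Type*} [MeasurableSpace Ω] (P : Measure Ω) (U : Ω → Plane → ℂ)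
    (r₁ r₂ : Plane) : ℂ :=
  ∫ ω, conj (U ω r₁) * U ω r₂ ∂P

/-- The integrand of the Wigner distribution function of the kernel `Γ`. -/
def wignerIntegrand (Γ : Plane → Plane → ℂ) (r p Δr : Plane) : ℂ :=
  Γ (r - (1 / 2 : ℝ) • Δr) (r + (1 / 2 : ℝ) • Δr) * exp (-I * (⟪p, Δr⟫ : ℝ))

/-- The Wigner distribution function of the kernel `Γ`; here `p` is a spatial frequency. -/
def wigner (Γ : Plane → Plane → ℂ) (r p : Plane) : ℂ :=
  (1 / (2 * Real.pi) ^ 2 : ℝ) * ∫ Δr, wignerIntegrand Γ r p Δr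

/-- The Wigner function at propagation distance `z` of the ensemble `U`, as a function of
position and of the dimensionless optical momentum `p`; the spatial frequency is `s k p`, where
`s = 1` for a field with carrier `exp (i k z)` and `s = -1` for a field with carrier
`exp (-i k z)`. -/
def opticalWigner {Ω : Type*} [MeasurableSpace Ω] (P : Measure Ω) (lam s : ℝ)
    (U : Ω → ℝ → 𝓢(Plane, ℂ)) (z : ℝ) (x : PhaseSpace) : ℂ :=
  wigner (csd P fun ω => U ω z) x.1 ((s * wavenumber lam) • x.2)

/-- Regularity of a random field, for `z` in the set `Z`. The field is random with measurable
values, and each of its Schwartz seminorms is, locally uniformly in `z`, bounded by a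
square-integrable random variable. A deterministic field qualifies if its Schwartz seminorms are
locally bounded in `z`. -/
structure IsRegularEnsemble {Ω : Type*} [MeasurableSpace Ω] (P : Measure Ω) (Z : Set ℝ)
    (U : Ω → ℝ → 𝓢(Plane, ℂ)) : Prop where
  measurable : ∀ z ∈ Z, ∀ r, Measurable fun ω => U ω z r
  seminorm_bound : ∀ (a b : ℕ), ∀ z₀ ∈ Z, ∃ ε > 0, ∃ g : Ω → ℝ, MemLp g 2 P ∧
    ∀ᵐ ω ∂P, ∀ z ∈ Z, |z - z₀| < ε → SchwartzMap.seminorm ℝ a b (U ω z) ≤ g ω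

/-! ### Wave equations -/

/-- The paraxial wave equation `2ik ∂U/∂z = σ (∇²U + k² (n² - 1) U)` for `z` in `Z`; the sign is
`σ = 1` for the carrier `exp (-i k z)` and `σ = -1` for the carrier `exp (i k z)`. -/
def SolvesParaxial (lam σ : ℝ) (n : Plane → ℝ) (Z : Set ℝ) (u : ℝ → 𝓢(Plane, ℂ)) : Prop :=
  ∀ z ∈ Z, ∀ r : Plane, DifferentiableAt ℝ (fun ζ => u ζ r) z ∧
    2 * I * wavenumber lam * deriv (fun ζ => u ζ r) z =
      σ * (Laplacian.laplacian (fun y : Plane => u z y) r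
        + (wavenumber lam : ℂ) ^ 2 * ((n r : ℂ) ^ 2 - 1) * u z r)

/-- Weyl quantization of the symbol `a`, with parameter `ħ`, as an iterated integral. -/
def weylOp (ħ : ℝ) (a : PhaseSpace → ℂ) (u : Plane → ℂ) (r : Plane) : ℂ :=
  (1 / (2 * Real.pi * ħ) ^ 2 : ℝ) *
    ∫ p : Plane, ∫ y : Plane,
      a ((1 / 2 : ℝ) • (r + y), p) * exp (I * (⟪p, r - y⟫ / ħ : ℝ)) * u y

/-- The Schrödinger-like equation `i ƛ ∂U/∂z = Ĥ U`, where `Ĥ` is the Weyl quantization of `H`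
with `ƛ = λ / 2π`. -/
def SolvesSchrodinger (lam : ℝ) (H : PhaseSpace → ℂ) (Z : Set ℝ) (u : ℝ → 𝓢(Plane, ℂ)) : Prop :=
  ∀ z ∈ Z, ∀ r : Plane, DifferentiableAt ℝ (fun ζ => u ζ r) z ∧
    I * reducedWavelength lam * deriv (fun ζ => u ζ r) z =
      weylOp (reducedWavelength lam) H (u z) r

/-! ### Hamiltonians -/

/-- The optical Hamiltonian `-n(r) + |p|² / (2 n(r))`, that is, `-√(n² - |p|²)` to first order
in `|p|²`. -/
def opticalHamiltonian (n : Plane → ℝ) (x : PhaseSpace) : ℂ :=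
  ((-n x.1 + ‖x.2‖ ^ 2 / (2 * n x.1) : ℝ) : ℂ)

/-- The Hamiltonian `|p|² / 2 - (n(r)² - 1) / 2` of the paraxial wave equation; up to an additive
constant it is `-√(n² - |p|²)` to first order in `n² - 1 - |p|²`. -/
def paraxialHamiltonian (n : Plane → ℝ) (x : PhaseSpace) : ℂ :=
  ((‖x.2‖ ^ 2 / 2 - (n x.1 ^ 2 - 1) / 2 : ℝ) : ℂ)

/-! ### The Poisson and Moyal brackets -/

/-- The Poisson bracket `∂A/∂r · ∂B/∂p - ∂A/∂p · ∂B/∂r`. -/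
def poissonBracket (A B : PhaseSpace → ℂ) (x : PhaseSpace) : ℂ :=
  ∑ i : Fin 2,
    (fderiv ℝ A x (EuclideanSpace.single i 1, 0) * fderiv ℝ B x (0, EuclideanSpace.single i 1)
      - fderiv ℝ A x (0, EuclideanSpace.single i 1) * fderiv ℝ B x (EuclideanSpace.single i 1, 0))

/-- The plane wave `exp (i (c · r + d · p))` on phase space, with frequency `ξ = (c, d)`. -/
def planeWave (ξ x : PhaseSpace) : ℂ :=
  exp (I * (⟪ξ.1, x.1⟫ + ⟪ξ.2, x.2⟫ : ℝ))

/-- The Fourier transform on phase space, so normalized that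
`B x = ∫ ξ, phaseFourier B ξ * planeWave ξ x`. -/
def phaseFourier (B : PhaseSpace → ℂ) (ξ : PhaseSpace) : ℂ :=
  (1 / (2 * Real.pi) ^ 4 : ℝ) * ∫ x, B x * planeWave ξ (-x)

/-- The translate of `x = (r, p)` to `(r - τ d, p + τ c)`, where `ξ = (c, d)`. -/
def poissonShift (τ : ℝ) (ξ x : PhaseSpace) : PhaseSpace :=
  (x.1 - τ • ξ.2, x.2 + τ • ξ.1)

/-- Write `Λ` for the bidifferential operator `(A, B) ↦ {A, B}`. If `B` is the plane wave of
frequency `ξ`, then `i τ Λ` acts on `A` as the derivative along `-τ d` in `r` and `τ c` in `p`,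
so that `exp (i τ Λ)` is the translation `poissonShift τ ξ` of `A`: this lemma is the
differential equation `d/dτ exp (i τ Λ) = i Λ exp (i τ Λ)`. -/
theorem hasDerivAt_poissonShift {A : PhaseSpace → ℂ} (hA : Differentiable ℝ A)
    (ξ x : PhaseSpace) (τ : ℝ) :
    HasDerivAt (fun t => A (poissonShift t ξ x) * planeWave ξ x)
      (I * poissonBracket (fun y => A (poissonShift τ ξ y)) (planeWave ξ) x) τ := by
  have hsh : ∀ y v, fderiv ℝ (fun y => A (poissonShift τ ξ y)) y v
      = fderiv ℝ A (poissonShift τ ξ y) v := by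
    intro y v
    have h : (fun y => A (poissonShift τ ξ y)) = fun y => A (y + (-(τ • ξ.2), τ • ξ.1)) := by
      funext y
      simp [poissonShift, sub_eq_add_neg, Prod.add_def]
    rw [h, fderiv_comp_add_right]
    congr 2
  have hpw : ∀ v : PhaseSpace, fderiv ℝ (planeWave ξ) x v
      = I * (⟪ξ.1, v.1⟫ + ⟪ξ.2, v.2⟫ : ℝ) * planeWave ξ x := by
    intro v
    let L : PhaseSpace →L[ℝ] ℝ :=
      (innerSL ℝ ξ.1).comp (ContinuousLinearMap.fst ℝ Plane Plane)
        + (innerSL ℝ ξ.2).comp (ContinuousLinearMap.snd ℝ Plane Plane)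
    have h1 : HasFDerivAt (fun y : PhaseSpace => I * ((L y : ℝ) : ℂ))
        (I • (ofRealCLM.comp L)) x :=
      ((ofRealCLM.comp L).hasFDerivAt).const_mul I
    have h2 : HasFDerivAt (planeWave ξ) _ x := h1.cexp
    rw [h2.fderiv]
    simp [L, planeWave]
    ring
  have hder : HasDerivAt (fun t => poissonShift t ξ x) (-ξ.2, ξ.1) τ := by
    have h1 : HasDerivAt (fun t : ℝ => x.1 - t • ξ.2) (-ξ.2) τ := by
      simpa using ((hasDerivAt_id τ).smul_const ξ.2).const_sub x.1
    have h2 : HasDerivAt (fun t : ℝ => x.2 + t • ξ.1) ξ.1 τ := by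
      simpa using ((hasDerivAt_id τ).smul_const ξ.1).const_add x.2
    exact h1.prodMk h2
  have hcomp := ((hA (poissonShift τ ξ x)).hasFDerivAt.comp_hasDerivAt τ hder).mul_const
    (planeWave ξ x)
  refine hcomp.congr_deriv ?_
  have hdec : ((-ξ.2, ξ.1) : PhaseSpace) = ∑ i : Fin 2,
      (ξ.1 i • ((0, EuclideanSpace.single i 1) : PhaseSpace)
        - ξ.2 i • ((EuclideanSpace.single i 1, 0) : PhaseSpace)) := by
    ext i <;> fin_cases i <;> simp [Fin.sum_univ_two]
  rw [hdec]
  simp only [poissonBracket, hsh, hpw, Fin.sum_univ_two, map_add, map_sub, map_smul]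
  simp [EuclideanSpace.inner_single_right]
  set D := fderiv ℝ A (poissonShift τ ξ x)
  linear_combination ((ξ.2 0 : ℂ) * D (EuclideanSpace.single 0 1, 0)
    - (ξ.1 0 : ℂ) * D (0, EuclideanSpace.single 0 1)
    + (ξ.2 1 : ℂ) * D (EuclideanSpace.single 1 1, 0)
    - (ξ.1 1 : ℂ) * D (0, EuclideanSpace.single 1 1)) * (-planeWave ξ x) * I_sq

/-- The integrand of `expPoisson`. -/
def expPoissonIntegrand (τ : ℝ) (A B : PhaseSpace → ℂ) (x ξ : PhaseSpace) : ℂ :=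
  phaseFourier B ξ * (A (poissonShift τ ξ x) * planeWave ξ x)

/-- `exp (i τ Λ)` applied to the pair `(A, B)`, where `Λ` is the Poisson bidifferential operator:
`B` is decomposed into plane waves and `exp (i τ Λ)` acts on each of them as a translation
of `A`. -/
def expPoisson (τ : ℝ) (A B : PhaseSpace → ℂ) (x : PhaseSpace) : ℂ :=
  ∫ ξ, expPoissonIntegrand τ A B x ξ

/-- `sin (τ Λ) = (exp (i τ Λ) - exp (-i τ Λ)) / 2i` applied to the pair `(A, B)`. -/
def sinPoisson (τ : ℝ) (A B : PhaseSpace → ℂ) (x : PhaseSpace) : ℂ :=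
  (expPoisson τ A B x - expPoisson (-τ) A B x) / (2 * I)

/-- The Moyal bracket `(2 / ħ) sin ((ħ / 2) Λ)` of `A` and `B`. -/
def moyalBracket (ħ : ℝ) (A B : PhaseSpace → ℂ) (x : PhaseSpace) : ℂ :=
  (2 / ħ : ℝ) * sinPoisson (ħ / 2) A B x

/-- All integrals in the Moyal bracket of `A` and `B` at `x` converge absolutely, and `B` is the
superposition of plane waves given by its Fourier transform. -/
structure MoyalDefined (ħ : ℝ) (A B : PhaseSpace → ℂ) (x : PhaseSpace) : Prop where
  integrable : Integrable B
  inversion : ∀ y, Integrable (fun ξ => phaseFourier B ξ * planeWave ξ y) ∧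
    B y = ∫ ξ, phaseFourier B ξ * planeWave ξ y
  integrable_pos : Integrable (expPoissonIntegrand (ħ / 2) A B x)
  integrable_neg : Integrable (expPoissonIntegrand (-(ħ / 2)) A B x)

/-- The transport equation `∂w/∂z = {{H, w}}` at every phase space point and every `z` in `Z`,
where the Moyal bracket has parameter `ħ`. -/
def SolvesWignerMoyal (ħ : ℝ) (H : PhaseSpace → ℂ) (Z : Set ℝ) (w : ℝ → PhaseSpace → ℂ) : Prop :=
  ∀ z ∈ Z, ∀ x, MoyalDefined ħ H (w z) x ∧
    HasDerivAt (fun ζ => w ζ x) (moyalBracket ħ H (w z) x) z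

end WignerOptics

end

open scoped LineDeriv FourierTransform

noncomputable section

namespace WignerOptics

/-! ### Averages of random Schwartz functions -/

/-! Write ħ for the reduced wavelength. The kernel K(r, Δ) = ⟨U*(r - Δ/2) U(r + Δ/2)⟩ is a Schwartz
function on phase space, and its Fourier transform in Δ, taken at the frequency p/ħ, is the Wigner
function W[K]. Both Hamiltonians have the form H = a(r) + |p|² b(r), and everything reduces to one
identity: exp(iħΛ/2)(H, W[K]) = W[Ĥ₂K], where Ĥ₂ is the Weyl quantization Ĥ of H acting on the
variable r + Δ/2 alone.

For the identity, decompose W[K] into plane waves of frequency (c, d). Its coefficient is, up to a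
constant, the Fourier transform of K in r, evaluated at Δ = -ħd (`phaseFourier_scaledWigner`). The
translation of r by -ħd/2 therefore evaluates a and b at r + Δ/2, while |p + ħc/2|² is a polynomial
in c, hence a differential operator in r (`expPoisson_scaledWigner`). The resulting kernel still
contains p; under the Fourier transform in Δ, p stands for -iħ∂_Δ, and substituting this gives Ĥ₂K
(`scaledWigner_moyalKernel`).

Since H and W[K] are real, exp(-iħΛ/2) yields the complex conjugate, so the Moyal bracket is
(iħ)⁻¹(W[Ĥ₂K] - conj W[Ĥ₂K]) (`moyalBracket_scaledWigner`). On the other side, if iħ ∂U/∂z = ĤU,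
differentiation under the average and under the Δ-integral (`hasDerivAt_wigner`) gives ∂W/∂z as the
same expression, because Ĥ₂ commutes with the average (`hamiltonKernel_correlation`).

It remains to bring each wave equation to this form. The Weyl integral is computed by Fourier
inversion (`weylOp_quadratic`). The paraxial equation reads iħ ∂U/∂z = -σĤU; for σ = 1 the conjugate
field solves the required equation, and conjugation reverses the momentum in the Wigner function
(`opticalWigner_neg_one`). -/

theorem exists_seminorm_le_sum {E D : Type*} [NormedAddCommGroup E] [NormedSpace ℝ E]
    [NormedAddCommGroup D] [NormedSpace ℝ D]
    (T : 𝓢(E, ℂ) →L[ℝ] 𝓢(D, ℂ)) (k l : ℕ) :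
    ∃ (s : Finset (ℕ × ℕ)) (C : ℝ), 0 ≤ C ∧ ∀ f : 𝓢(E, ℂ),
      SchwartzMap.seminorm ℝ k l (T f) ≤ C * ∑ i ∈ s, SchwartzMap.seminorm ℝ i.1 i.2 f := by
  have hc : Continuous ((SchwartzMap.seminorm ℝ k l).comp (T : 𝓢(E, ℂ) →ₗ[ℝ] 𝓢(D, ℂ))) :=
    ((schwartz_withSeminorms ℝ D ℂ).continuous_seminorm (k, l)).comp T.continuous
  obtain ⟨s, C, -, hle⟩ := Seminorm.bound_of_continuous (schwartz_withSeminorms ℝ E ℂ) _ hc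
  refine ⟨s, C, C.2, fun f => (hle f).trans ?_⟩
  -- The supremum of seminorms is replaced by their sum because finite sums of random variables in
  -- `Lᵖ` remain in `Lᵖ`.
  have h2 := (Seminorm.finset_sup_le_sum (schwartzSeminormFamily ℝ E ℂ) s) f
  rw [smul_apply, NNReal.smul_def, smul_eq_mul]
  refine mul_le_mul_of_nonneg_left (h2.trans (le_of_eq ?_)) C.2
  simp [sum_apply, schwartzSeminormFamily]

section Average

variable {Ω E : Type*} [MeasurableSpace Ω] [NormedAddCommGroup E] [NormedSpace ℝ E]

/-- A random Schwartz function with measurable values all of whose seminorms are bounded by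
random variables in `Lᵖ`. -/
structure IsMemLpFamily (p : ENNReal) (P : Measure Ω) (f : Ω → 𝓢(E, ℂ)) : Prop where
  measurable : ∀ x, Measurable fun ω => f ω x
  seminorm_bound : ∀ k l : ℕ, ∃ G : Ω → ℝ, MemLp G p P ∧
    ∀ᵐ ω ∂P, SchwartzMap.seminorm ℝ k l (f ω) ≤ G ω

namespace IsMemLpFamily

variable {p : ENNReal} {P : Measure Ω} {f : Ω → 𝓢(E, ℂ)}

theorem map {D : Type*} [NormedAddCommGroup D] [NormedSpace ℝ D] (hf : IsMemLpFamily p P f)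
    (T : 𝓢(E, ℂ) →L[ℝ] 𝓢(D, ℂ)) (hT : ∀ x, Measurable fun ω => T (f ω) x) :
    IsMemLpFamily p P fun ω => T (f ω) where
  measurable := hT
  seminorm_bound k l := by
    obtain ⟨s, C, hC, hle⟩ := exists_seminorm_le_sum T k l
    choose G hG hGle using hf.seminorm_bound
    have hsum : MemLp (fun ω => ∑ i ∈ s, G i.1 i.2 ω) p P :=
      memLp_finsetSum s fun i _ => hG i.1 i.2
    refine ⟨fun ω => C * ∑ i ∈ s, G i.1 i.2 ω, hsum.const_mul C, ?_⟩
    filter_upwards [ae_all_iff.2 fun k => ae_all_iff.2 fun l => hGle k l] with ω hω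
    exact (hle (f ω)).trans
      (mul_le_mul_of_nonneg_left (Finset.sum_le_sum fun i _ => hω i.1 i.2) hC)

theorem integrable (hf : IsMemLpFamily 1 P f) (x : E) : Integrable (fun ω => f ω x) P := by
  obtain ⟨G, hG, hle⟩ := hf.seminorm_bound 0 0
  refine (memLp_one_iff_integrable.1 hG).mono' (hf.measurable x).aestronglyMeasurable ?_
  filter_upwards [hle] with ω hω
  exact ((f ω).norm_le_seminorm ℝ x).trans hω

end IsMemLpFamily

variable [FiniteDimensional ℝ E]

/-- Each directional derivative is a limit of difference quotients along the steps 1/c, and in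
finite dimension finitely many directions determine the whole derivative. -/
theorem stronglyMeasurable_fderiv_of_pointwise {F : Type*} [NormedAddCommGroup F]
    [NormedSpace ℝ F] {g : Ω → E → F} {x : E} (hd : ∀ ω, DifferentiableAt ℝ (g ω) x)
    (hm : ∀ y, StronglyMeasurable fun ω => g ω y) :
    StronglyMeasurable fun ω => fderiv ℝ (g ω) x := by
  let b := Module.finBasis ℝ E
  have hdir : ∀ v, StronglyMeasurable fun ω => fderiv ℝ (g ω) x v := by
    intro v
    refine stronglyMeasurable_of_tendsto Filter.atTop
      (f := fun (c : ℕ) ω => (c : ℝ) • (g ω (x + (c : ℝ)⁻¹ • v) - g ω x)) ?_ ?_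
    · intro c
      exact ((hm _).sub (hm _)).const_smul _
    · refine tendsto_pi_nhds.2 fun ω => ?_
      exact ((hd ω).hasFDerivAt.lim_real v).comp tendsto_natCast_atTop_atTop
  have heq : (fun ω => fderiv ℝ (g ω) x) = fun ω => ∑ i,
      ContinuousLinearMap.smulRightL ℝ E F (LinearMap.toContinuousLinearMap (b.coord i))
        (fderiv ℝ (g ω) x (b i)) := by
    funext ω
    ext v
    simp only [sum_apply, ContinuousLinearMap.smulRightL_apply_apply]
    conv_lhs => rw [← b.sum_repr v]
    simp only [map_sum, map_smul]
    rfl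
  rw [heq]
  exact Finset.stronglyMeasurable_fun_sum _ fun i _ =>
    (ContinuousLinearMap.continuous _).comp_stronglyMeasurable (hdir _)

theorem stronglyMeasurable_iteratedFDeriv_of_pointwise {f : Ω → 𝓢(E, ℂ)}
    (hm : ∀ y, Measurable fun ω => f ω y) (m : ℕ) (x : E) :
    StronglyMeasurable fun ω => iteratedFDeriv ℝ m (f ω) x := by
  induction m generalizing x with
  | zero =>
    simp only [iteratedFDeriv_zero_eq_comp]
    exact (LinearIsometryEquiv.continuous _).comp_stronglyMeasurable (hm x).stronglyMeasurable
  | succ m ih =>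
    simp only [iteratedFDeriv_succ_eq_comp_left]
    refine (LinearIsometryEquiv.continuous _).comp_stronglyMeasurable
      (stronglyMeasurable_fderiv_of_pointwise (fun ω => ?_) ih)
    exact ((f ω).smooth ⊤).differentiable_iteratedFDeriv (by exact_mod_cast WithTop.coe_lt_top _) x

namespace IsMemLpFamily

variable {p : ENNReal} {P : Measure Ω} {f : Ω → 𝓢(E, ℂ)}

theorem measurable_lineDerivOp (hf : IsMemLpFamily p P f) (v x : E) :
    Measurable fun ω => (∂_{v} (f ω)) x := by
  have h := stronglyMeasurable_fderiv_of_pointwise (g := fun ω => (f ω : E → ℂ)) (x := x)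
    (fun ω => (f ω).differentiableAt) fun y => (hf.measurable y).stronglyMeasurable
  exact (StronglyMeasurable.apply_continuousLinearMap h v).measurable

theorem lineDerivOp (hf : IsMemLpFamily p P f) (v : E) :
    IsMemLpFamily p P fun ω => ∂_{v} (f ω) :=
  hf.map (LineDeriv.lineDerivOpCLM ℝ 𝓢(E, ℂ) v) (hf.measurable_lineDerivOp v)

theorem integrable_iteratedFDeriv (hf : IsMemLpFamily 1 P f) (m : ℕ) (x : E) :
    Integrable (fun ω => iteratedFDeriv ℝ m (f ω) x) P := by
  obtain ⟨G, hG, hle⟩ := hf.seminorm_bound 0 m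
  refine (memLp_one_iff_integrable.1 hG).mono' (stronglyMeasurable_iteratedFDeriv_of_pointwise
    hf.measurable m x).aestronglyMeasurable ?_
  filter_upwards [hle] with ω hω
  exact ((f ω).norm_iteratedFDeriv_le_seminorm ℝ m x).trans hω

theorem hasFDerivAt_integral_iteratedFDeriv (hf : IsMemLpFamily 1 P f) (m : ℕ) (x : E) :
    HasFDerivAt (fun y => ∫ ω, iteratedFDeriv ℝ m (f ω) y ∂P)
      (∫ ω, fderiv ℝ (iteratedFDeriv ℝ m (f ω)) x ∂P) x := by
  obtain ⟨G, hG, hle⟩ := hf.seminorm_bound 0 (m + 1)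
  have hdiff : ∀ ω, Differentiable ℝ (iteratedFDeriv ℝ m (f ω)) := fun ω =>
    ((f ω).smooth ⊤).differentiable_iteratedFDeriv (by exact_mod_cast WithTop.coe_lt_top _)
  have hmeas := stronglyMeasurable_iteratedFDeriv_of_pointwise hf.measurable m
  -- The seminorm of order (0, m + 1) bounds the next derivative uniformly in the point, so the
  -- dominated region can be the whole space.
  refine hasFDerivAt_integral_of_dominated_of_fderiv_le (s := Set.univ) (bound := G)
    (F' := fun y ω => fderiv ℝ (iteratedFDeriv ℝ m (f ω)) y) Filter.univ_mem
    (Filter.Eventually.of_forall fun y => (hmeas y).aestronglyMeasurable)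
    (hf.integrable_iteratedFDeriv m x)
    (stronglyMeasurable_fderiv_of_pointwise (fun ω => hdiff ω x) hmeas).aestronglyMeasurable
    ?_ (memLp_one_iff_integrable.1 hG) (Filter.Eventually.of_forall fun ω y _ => (hdiff ω y).hasFDerivAt)
  filter_upwards [hle] with ω hω y _
  rw [norm_fderiv_iteratedFDeriv]
  exact ((f ω).norm_iteratedFDeriv_le_seminorm ℝ (m + 1) y).trans hω

theorem hasFTaylorSeriesUpTo (hf : IsMemLpFamily 1 P f) :
    HasFTaylorSeriesUpTo ((⊤ : ℕ∞) : WithTop ℕ∞) (fun x => ∫ ω, f ω x ∂P)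
      (fun x m => ∫ ω, iteratedFDeriv ℝ m (f ω) x ∂P) where
  zero_eq x := by
    have h := ((continuousMultilinearCurryFin0 ℝ E ℂ).toContinuousLinearEquiv :
      _ →L[ℝ] ℂ).integral_comp_comm (hf.integrable_iteratedFDeriv 0 x)
    simpa using h.symm
  fderiv m _ x := by
    have h := hf.hasFDerivAt_integral_iteratedFDeriv m x
    convert h using 1
    let e : (E [×(m + 1)]→L[ℝ] ℂ) ≃ₗᵢ[ℝ] (E →L[ℝ] E [×m]→L[ℝ] ℂ) :=
      continuousMultilinearCurryLeftEquiv ℝ (fun _ => E) ℂ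
    have h2 := ContinuousLinearMap.integral_comp_comm (𝕜 := ℝ)
      (Fₗ := E →L[ℝ] E [×m]→L[ℝ] ℂ) e.toContinuousLinearEquiv.toContinuousLinearMap
      (hf.integrable_iteratedFDeriv (m + 1) x)
    simp only [fderiv_iteratedFDeriv]
    exact h2.symm
  cont m _ := continuous_iff_continuousAt.2 fun x =>
    (hf.hasFDerivAt_integral_iteratedFDeriv m x).continuousAt

/-- The average of an integrable family of Schwartz functions. -/
def average (hf : IsMemLpFamily 1 P f) : 𝓢(E, ℂ) where
  toFun x := ∫ ω, f ω x ∂P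
  smooth' := hf.hasFTaylorSeriesUpTo.contDiff
  decay' k l := by
    obtain ⟨G, hG, hle⟩ := hf.seminorm_bound k l
    refine ⟨∫ ω, G ω ∂P, fun x => ?_⟩
    rw [← hf.hasFTaylorSeriesUpTo.eq_iteratedFDeriv (by exact_mod_cast le_top) x]
    have h1 : ‖x‖ ^ k * ‖∫ ω, iteratedFDeriv ℝ l (f ω) x ∂P‖
        = ‖∫ ω, (‖x‖ ^ k) • iteratedFDeriv ℝ l (f ω) x ∂P‖ := by
      rw [integral_smul, norm_smul]
      simp
    rw [h1]
    refine norm_integral_le_of_norm_le (memLp_one_iff_integrable.1 hG) ?_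
    filter_upwards [hle] with ω hω
    rw [norm_smul]
    simpa using ((f ω).le_seminorm ℝ k l x).trans hω

@[simp]
theorem average_apply (hf : IsMemLpFamily 1 P f) (x : E) :
    hf.average x = ∫ ω, f ω x ∂P := rfl

theorem lineDerivOp_average (hf : IsMemLpFamily 1 P f) (v : E) :
    ∂_{v} hf.average = (hf.lineDerivOp v).average := by
  ext x
  have h1 : ∀ g : 𝓢(E, ℂ), (∂_{v} g) x
      = ContinuousMultilinearMap.apply ℝ (fun _ : Fin 1 => E) ℂ (fun _ => v)
        (iteratedFDeriv ℝ 1 g x) := fun g => by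
    rw [← LineDeriv.iteratedLineDerivOp_one (fun _ => v),
      SchwartzMap.iteratedLineDerivOp_eq_iteratedFDeriv]
    rfl
  have h2 := hf.hasFTaylorSeriesUpTo.eq_iteratedFDeriv (m := 1) (by exact_mod_cast le_top) x
  rw [average_apply, h1]
  simp only [h1]
  rw [ContinuousLinearMap.integral_comp_comm _ (hf.integrable_iteratedFDeriv 1 x), h2]
  rfl

end IsMemLpFamily

end Average

/-! ### Products of fields at symmetric points -/

/-- The linear map `(r, Δ) ↦ r + c Δ`. -/
def shiftCLM (c : ℝ) : PhaseSpace →L[ℝ] Plane :=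
  ContinuousLinearMap.fst ℝ Plane Plane + c • ContinuousLinearMap.snd ℝ Plane Plane

@[simp]
theorem shiftCLM_apply (c : ℝ) (x : PhaseSpace) : shiftCLM c x = x.1 + c • x.2 := rfl

theorem norm_shiftCLM_le {c : ℝ} (hc : |c| ≤ 1) : ‖shiftCLM c‖ ≤ 2 := by
  refine ContinuousLinearMap.opNorm_le_bound _ (by norm_num) fun x => ?_
  rw [shiftCLM_apply]
  calc ‖x.1 + c • x.2‖ ≤ ‖x.1‖ + ‖c • x.2‖ := norm_add_le _ _
    _ ≤ ‖x‖ + 1 * ‖x‖ := by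
        rw [norm_smul]
        gcongr
        · exact norm_fst_le x
        · exact hc
        · exact norm_snd_le x
    _ = 2 * ‖x‖ := by ring

theorem norm_iteratedFDeriv_comp_shiftCLM_le {c : ℝ} (hc : |c| ≤ 1) (u : 𝓢(Plane, ℂ)) (i : ℕ)
    (x : PhaseSpace) : ‖iteratedFDeriv ℝ i (fun y => u (shiftCLM c y)) x‖
      ≤ 2 ^ i * ‖iteratedFDeriv ℝ i u (shiftCLM c x)‖ := by
  have h := (shiftCLM c).iteratedFDeriv_comp_right (u.smooth ⊤) x (i := i)
    (by exact_mod_cast le_top)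
  rw [show (fun y => u (shiftCLM c y)) = u ∘ shiftCLM c from rfl, h]
  refine (ContinuousMultilinearMap.norm_compContinuousLinearMap_le _ _).trans ?_
  rw [mul_comm, Finset.prod_const, Finset.card_univ, Fintype.card_fin]
  gcongr
  exact norm_shiftCLM_le hc

/-- The position is the midpoint of r ∓ Δ/2 and Δ is their difference. Hence decay at the two
endpoints gives joint decay in (r, Δ). -/
theorem norm_le_norm_sub_add_norm_add (x : PhaseSpace) :
    ‖x‖ ≤ ‖shiftCLM (-(1 / 2)) x‖ + ‖shiftCLM (1 / 2) x‖ := by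
  have h1 : x.1 = (1 / 2 : ℝ) • (shiftCLM (-(1 / 2)) x + shiftCLM (1 / 2) x) := by
    simp only [shiftCLM_apply]
    module
  have h2 : x.2 = shiftCLM (1 / 2) x - shiftCLM (-(1 / 2)) x := by
    simp only [shiftCLM_apply]
    module
  rw [Prod.norm_def, max_le_iff]
  constructor
  · rw [h1, norm_smul]
    refine (mul_le_of_le_one_left (norm_nonneg _) (by norm_num)).trans (norm_add_le _ _)
  · rw [h2, add_comm]
    exact norm_sub_le _ _

/-- A bound for the seminorms of `symmetricProduct u v`. -/
def symmetricProductBound (k l : ℕ) (u v : 𝓢(Plane, ℂ)) : ℝ :=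
  ∑ i ∈ Finset.range (l + 1), (2 ^ k * (l.choose i : ℝ) * 2 ^ l) *
    (SchwartzMap.seminorm ℝ k i u * SchwartzMap.seminorm ℝ 0 (l - i) v
      + SchwartzMap.seminorm ℝ 0 i u * SchwartzMap.seminorm ℝ k (l - i) v)

theorem symmetricProduct_decay (k l : ℕ) (u v : 𝓢(Plane, ℂ)) (x : PhaseSpace) :
    ‖x‖ ^ k * ‖iteratedFDeriv ℝ l
      (fun y : PhaseSpace => u (shiftCLM (-(1 / 2)) y) * v (shiftCLM (1 / 2) y)) x‖
      ≤ symmetricProductBound k l u v := by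
  have hc1 : |(-(1 / 2) : ℝ)| ≤ 1 := by norm_num [abs_le]
  have hc2 : |(1 / 2 : ℝ)| ≤ 1 := by norm_num [abs_le]
  have hb := (ContinuousLinearMap.mul ℝ ℂ).norm_iteratedFDeriv_le_of_bilinear
    (N := ((⊤ : ℕ∞) : WithTop ℕ∞))
    ((u.smooth ⊤).comp (shiftCLM (-(1 / 2))).contDiff)
    ((v.smooth ⊤).comp (shiftCLM (1 / 2)).contDiff) x (n := l) (by exact_mod_cast le_top)
  have hb' : ‖iteratedFDeriv ℝ l
      (fun y : PhaseSpace => u (shiftCLM (-(1 / 2)) y) * v (shiftCLM (1 / 2) y)) x‖ ≤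
      ∑ i ∈ Finset.range (l + 1), (l.choose i : ℝ) *
        (2 ^ i * ‖iteratedFDeriv ℝ i u (shiftCLM (-(1 / 2)) x)‖) *
        (2 ^ (l - i) * ‖iteratedFDeriv ℝ (l - i) v (shiftCLM (1 / 2) x)‖) := by
    refine hb.trans ((mul_le_of_le_one_left (by positivity)
      (ContinuousLinearMap.opNorm_mul_le ℝ ℂ)).trans ?_)
    gcongr with i
    · exact norm_iteratedFDeriv_comp_shiftCLM_le hc1 u i x
    · exact norm_iteratedFDeriv_comp_shiftCLM_le hc2 v (l - i) x
  have hx : ‖x‖ ^ k ≤ 2 ^ k * (‖shiftCLM (-(1 / 2)) x‖ ^ k + ‖shiftCLM (1 / 2) x‖ ^ k) := by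
    refine (pow_le_pow_left₀ (norm_nonneg _) (norm_le_norm_sub_add_norm_add x) k).trans ?_
    refine (add_pow_le (norm_nonneg _) (norm_nonneg _) k).trans ?_
    gcongr
    · norm_num
    · omega
  refine (mul_le_mul hx hb' (norm_nonneg _) (by positivity)).trans ?_
  rw [symmetricProductBound, Finset.mul_sum]
  refine Finset.sum_le_sum fun i hi => ?_
  have hil : i ≤ l := by simpa [Nat.lt_succ_iff] using hi
  set r₁ := shiftCLM (-(1 / 2)) x
  set r₂ := shiftCLM (1 / 2) x
  have e1 := u.le_seminorm ℝ k i r₁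
  have e2 := u.norm_iteratedFDeriv_le_seminorm ℝ i r₁
  have e3 := v.le_seminorm ℝ k (l - i) r₂
  have e4 := v.norm_iteratedFDeriv_le_seminorm ℝ (l - i) r₂
  have h2 : (2 : ℝ) ^ l = 2 ^ i * 2 ^ (l - i) := by rw [← pow_add, Nat.add_sub_cancel' hil]
  rw [h2]
  calc _ = (2 ^ k * (l.choose i : ℝ) * (2 ^ i * 2 ^ (l - i))) *
      ((‖r₁‖ ^ k * ‖iteratedFDeriv ℝ i u r₁‖) * ‖iteratedFDeriv ℝ (l - i) v r₂‖
        + ‖iteratedFDeriv ℝ i u r₁‖ * (‖r₂‖ ^ k * ‖iteratedFDeriv ℝ (l - i) v r₂‖)) := by ring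
    _ ≤ _ := by gcongr

/-- The Schwartz function `(r, Δ) ↦ u (r - Δ / 2) v (r + Δ / 2)`. -/
def symmetricProduct (u v : 𝓢(Plane, ℂ)) : 𝓢(PhaseSpace, ℂ) where
  toFun y := u (shiftCLM (-(1 / 2)) y) * v (shiftCLM (1 / 2) y)
  smooth' := ((u.smooth ⊤).comp (shiftCLM (-(1 / 2))).contDiff).mul
    ((v.smooth ⊤).comp (shiftCLM (1 / 2)).contDiff)
  decay' k l := ⟨_, symmetricProduct_decay k l u v⟩

theorem symmetricProduct_apply (u v : 𝓢(Plane, ℂ)) (x : PhaseSpace) :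
    symmetricProduct u v x = u (shiftCLM (-(1 / 2)) x) * v (shiftCLM (1 / 2) x) := rfl

theorem seminorm_symmetricProduct_le (k l : ℕ) (u v : 𝓢(Plane, ℂ)) :
    SchwartzMap.seminorm ℝ k l (symmetricProduct u v) ≤ symmetricProductBound k l u v :=
  SchwartzMap.seminorm_le_bound ℝ k l _
    (Finset.sum_nonneg fun _ _ => by positivity) (symmetricProduct_decay k l u v)

/-- Along (e/2, e) the point r - Δ/2 stays fixed and r + Δ/2 moves with velocity e, so only the
second factor is differentiated. -/
theorem lineDerivOp_symmetricProduct (e : Plane) (u v : 𝓢(Plane, ℂ)) :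
    ∂_{(((1 / 2 : ℝ) • e, e) : PhaseSpace)} (symmetricProduct u v)
      = symmetricProduct u (∂_{e} v) := by
  ext x
  have hu : HasFDerivAt (fun y => u (shiftCLM (-(1 / 2)) y))
      ((fderiv ℝ u (shiftCLM (-(1 / 2)) x)).comp (shiftCLM (-(1 / 2)))) x :=
    (u.hasFDerivAt _).comp x (shiftCLM (-(1 / 2))).hasFDerivAt
  have hv : HasFDerivAt (fun y => v (shiftCLM (1 / 2) y))
      ((fderiv ℝ v (shiftCLM (1 / 2) x)).comp (shiftCLM (1 / 2))) x :=
    (v.hasFDerivAt _).comp x (shiftCLM (1 / 2)).hasFDerivAt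
  have h := hu.mul hv
  rw [SchwartzMap.lineDerivOp_apply_eq_fderiv, symmetricProduct_apply,
    SchwartzMap.lineDerivOp_apply_eq_fderiv]
  have h1 : shiftCLM (-(1 / 2)) (((1 / 2 : ℝ) • e, e) : PhaseSpace) = 0 := by
    simp only [shiftCLM_apply]; module
  have h2 : shiftCLM (1 / 2) (((1 / 2 : ℝ) • e, e) : PhaseSpace) = e := by
    simp only [shiftCLM_apply]; module
  have h3 : fderiv ℝ (symmetricProduct u v) x = _ := h.fderiv
  rw [h3]
  simp only [add_apply, smul_apply, ContinuousLinearMap.comp_apply, h1, h2, map_zero, smul_eq_mul]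
  ring

/-- Complex conjugation of Schwartz functions. -/
def conjSchwartz : 𝓢(Plane, ℂ) →L[ℝ] 𝓢(Plane, ℂ) :=
  SchwartzMap.postcompCLM (conjCLE : ℂ →L[ℝ] ℂ)

@[simp]
theorem conjSchwartz_apply (u : 𝓢(Plane, ℂ)) (r : Plane) : conjSchwartz u r = conj (u r) := rfl

section Families

variable {Ω : Type*} [MeasurableSpace Ω] {P : Measure Ω} {u v : Ω → 𝓢(Plane, ℂ)}

theorem IsMemLpFamily.conjSchwartz {p : ENNReal} (hu : IsMemLpFamily p P u) :
    IsMemLpFamily p P fun ω => conjSchwartz (u ω) :=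
  hu.map _ fun x => by
    exact continuous_conj.measurable.comp (hu.measurable x)

/-- The seminorm bound is bilinear in the two fields, so Hölder's inequality turns two
square-integrable bounds into an integrable one. -/
theorem IsMemLpFamily.symmetricProduct (hu : IsMemLpFamily 2 P u) (hv : IsMemLpFamily 2 P v) :
    IsMemLpFamily 1 P fun ω => symmetricProduct (u ω) (v ω) where
  measurable x := (hu.measurable _).mul (hv.measurable _)
  seminorm_bound k l := by
    choose g hg hgle using hu.seminorm_bound
    choose h hh hhle using hv.seminorm_bound
    refine ⟨fun ω => ∑ i ∈ Finset.range (l + 1), (2 ^ k * (l.choose i : ℝ) * 2 ^ l) *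
      (g k i ω * h 0 (l - i) ω + g 0 i ω * h k (l - i) ω), ?_, ?_⟩
    · refine memLp_one_iff_integrable.2 (integrable_finsetSum _ fun i _ => Integrable.const_mul
        (((hg k i).integrable_mul (hh 0 (l - i))).add ((hg 0 i).integrable_mul (hh k (l - i)))) _)
    · filter_upwards [ae_all_iff.2 fun k => ae_all_iff.2 fun l => hgle k l,
        ae_all_iff.2 fun k => ae_all_iff.2 fun l => hhle k l] with ω hω hω'
      refine (seminorm_symmetricProduct_le k l _ _).trans ?_
      have hg0 : ∀ k i, 0 ≤ g k i ω := fun k i => (apply_nonneg _ _).trans (hω k i)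
      unfold symmetricProductBound
      gcongr with i
      exacts [hg0 k i, hω k i, hω' 0 (l - i), hg0 0 i, hω 0 i, hω' k (l - i)]

end Families

/-! ### Calculus of Schwartz functions -/

section Calculus

variable {E : Type*} [NormedAddCommGroup E] [NormedSpace ℝ E]

theorem lineDerivOp_comm (v w : E) (f : 𝓢(E, ℂ)) : ∂_{v} (∂_{w} f) = ∂_{w} (∂_{v} f) := by
  have h : ∀ a b : E, ∀ x, (∂_{a} (∂_{b} f)) x = fderiv ℝ (fderiv ℝ f) x a b := by
    intro a b x
    have hd : DifferentiableAt ℝ (fderiv ℝ f) x :=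
      (SchwartzMap.fderivCLM ℝ E ℂ f).differentiableAt
    rw [SchwartzMap.lineDerivOp_apply_eq_fderiv]
    have h1 : (∂_{b} f : 𝓢(E, ℂ)) = fun y => fderiv ℝ f y b := rfl
    rw [h1, fderiv_clm_apply hd (differentiableAt_const b)]
    simp
  ext x
  rw [h, h]
  exact (f.contDiffAt 2).isSymmSndFDerivAt (by simp) v w

theorem hasTemperateGrowth_fderiv_apply {F : Type*} [NormedAddCommGroup F] [NormedSpace ℝ F]
    {g : E → F} (hg : g.HasTemperateGrowth) (v : E) :
    (fun x => fderiv ℝ g x v).HasTemperateGrowth := by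
  have h : (fderiv ℝ g).HasTemperateGrowth := by
    refine ⟨hg.1.fderiv_right (by simp), fun m => ?_⟩
    obtain ⟨k, C, hC⟩ := hg.2 (m + 1)
    refine ⟨k, C, fun x => ?_⟩
    rw [norm_iteratedFDeriv_fderiv]
    exact hC x
  exact (ContinuousLinearMap.apply ℝ F v).hasTemperateGrowth.comp h

theorem lineDerivOp_smulLeftCLM {g : E → ℂ} (hg : g.HasTemperateGrowth) (v : E) (f : 𝓢(E, ℂ)) :
    ∂_{v} (SchwartzMap.smulLeftCLM ℂ g f) = SchwartzMap.smulLeftCLM ℂ g (∂_{v} f)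
      + SchwartzMap.smulLeftCLM ℂ (fun x => fderiv ℝ g x v) f := by
  ext x
  have hgd : DifferentiableAt ℝ g x := hg.1.differentiable (by simp) x
  rw [add_apply, SchwartzMap.smulLeftCLM_apply_apply hg,
    SchwartzMap.smulLeftCLM_apply_apply (hasTemperateGrowth_fderiv_apply hg v),
    SchwartzMap.lineDerivOp_apply_eq_fderiv, SchwartzMap.lineDerivOp_apply_eq_fderiv,
    SchwartzMap.smulLeftCLM_apply hg]
  have h := hgd.hasFDerivAt.fun_smul (f.hasFDerivAt x)
  rw [h.fderiv]
  simp

end Calculus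

/-! ### The Fourier transform on the plane -/

theorem two_pi_inv_ne_zero : (2 * Real.pi)⁻¹ ≠ 0 := inv_ne_zero (by positivity)

/-- The Fourier transform `q ↦ ∫ g(y) exp (-i q · y) dy`. -/
def planeFourier : 𝓢(Plane, ℂ) →L[ℂ] 𝓢(Plane, ℂ) :=
  (SchwartzMap.compCLMOfContinuousLinearEquiv ℂ
    (ContinuousLinearEquiv.smulLeft (Units.mk0 (2 * Real.pi)⁻¹ two_pi_inv_ne_zero) :
      Plane ≃L[ℝ] Plane)) ∘L FourierTransform.fourierCLM ℂ 𝓢(Plane, ℂ)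

theorem planeFourier_apply_eq_fourier (g : 𝓢(Plane, ℂ)) (q : Plane) :
    planeFourier g q = 𝓕 g ((2 * Real.pi)⁻¹ • q) := rfl

theorem planeFourier_apply (g : 𝓢(Plane, ℂ)) (q : Plane) :
    planeFourier g q = ∫ y, g y * exp (-I * (⟪q, y⟫ : ℝ)) := by
  rw [planeFourier_apply_eq_fourier, SchwartzMap.fourier_coe, Real.fourier_eq]
  congr 1
  ext y
  rw [Circle.smul_def, Real.fourierChar_apply, smul_eq_mul, mul_comm, inner_smul_right,
    real_inner_comm]
  congr 2
  push_cast
  have : (Real.pi : ℂ) ≠ 0 := by exact_mod_cast Real.pi_ne_zero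
  field_simp

theorem norm_exp_neg_I_mul_ofReal (t : ℝ) : ‖exp (-I * (t : ℂ))‖ = 1 := by
  rw [neg_mul, mul_comm, ← neg_mul, ← ofReal_neg, norm_exp_ofReal_mul_I]

theorem integrable_mul_exp_neg (g : 𝓢(Plane, ℂ)) (q : Plane) :
    Integrable fun y => g y * exp (-I * (⟪q, y⟫ : ℝ)) :=
  g.integrable.mul_bdd (c := 1) (Continuous.aestronglyMeasurable (by fun_prop))
    (Filter.Eventually.of_forall fun y => (norm_exp_neg_I_mul_ofReal _).le)

theorem planeFourier_lineDerivOp (g : 𝓢(Plane, ℂ)) (v q : Plane) :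
    planeFourier (∂_{v} g) q = I * (⟪q, v⟫ : ℝ) * planeFourier g q := by
  have ht : (fun x : Plane => ⟪x, v⟫).HasTemperateGrowth := by fun_prop
  rw [planeFourier_apply_eq_fourier, SchwartzMap.fourier_lineDerivOp_eq, smul_apply,
    SchwartzMap.smulLeftCLM_apply_apply ht, planeFourier_apply_eq_fourier, inner_smul_left]
  simp only [smul_eq_mul, real_smul]
  push_cast
  have : (Real.pi : ℂ) ≠ 0 := by exact_mod_cast Real.pi_ne_zero
  simp
  field_simp

theorem integral_comp_smul_plane (f : Plane → ℂ) (R : ℝ) :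
    ∫ x, f (R • x) = ((R ^ 2)⁻¹ : ℝ) * ∫ x, f x := by
  rw [Measure.integral_comp_smul, finrank_euclideanSpace_fin, abs_of_nonneg (by positivity),
    real_smul]

theorem integral_planeFourier_mul_exp (g : 𝓢(Plane, ℂ)) (y : Plane) :
    ∫ q, planeFourier g q * exp (I * (⟪q, y⟫ : ℝ)) = ((2 * Real.pi) ^ 2 : ℝ) * g y := by
  have h1 : g y = 𝓕⁻ (𝓕 g) y := by rw [FourierTransform.fourierInv_fourier_eq]
  rw [SchwartzMap.fourierInv_coe, Real.fourierInv_eq] at h1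
  have h2 : ∀ q, planeFourier g q * exp (I * (⟪q, y⟫ : ℝ))
      = (fun η : Plane => Real.fourierChar ⟪η, y⟫ • 𝓕 g η) ((2 * Real.pi)⁻¹ • q) := by
    intro q
    simp only [planeFourier_apply_eq_fourier]
    rw [Circle.smul_def, Real.fourierChar_apply, smul_eq_mul, mul_comm, inner_smul_left]
    congr 2
    have : (Real.pi : ℂ) ≠ 0 := by exact_mod_cast Real.pi_ne_zero
    simp
    field_simp
  -- The factor (2π)² is the Jacobian, in dimension two, of the rescaling between the two Fourier
  -- conventions.
  rw [integral_congr_ae (Filter.Eventually.of_forall h2), integral_comp_smul_plane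
    (fun η : Plane => Real.fourierChar ⟪η, y⟫ • 𝓕 g η), ← h1, inv_pow, inv_inv]

/-- The `j`-th standard basis vector of the plane. -/
def basisVec (j : Fin 2) : Plane := EuclideanSpace.single j 1

theorem inner_basisVec (q : Plane) (j : Fin 2) : ⟪q, basisVec j⟫ = q j := by
  rw [basisVec, EuclideanSpace.inner_single_right]
  simp

/-- Expand |p + τc|² = |p|² + 2τ c·p + τ²|c|² and replace c by -i∂: a polynomial factor in frequency
is a differential operator on g. -/
theorem planeFourier_symbol (g : 𝓢(Plane, ℂ)) (α β : ℂ) (τ : ℝ) (p c : Plane) :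
    planeFourier g c * (α + ((‖p + τ • c‖ ^ 2 : ℝ) : ℂ) * β) =
      planeFourier (α • g + β • (((‖p‖ ^ 2 : ℝ) : ℂ) • g - (2 * I * τ) • ∂_{p} g
        - ((τ : ℂ) ^ 2) • ∑ j : Fin 2,
          ∂_{basisVec j} (∂_{basisVec j} g))) c := by
  have hn : ‖p + τ • c‖ ^ 2 = ‖p‖ ^ 2 + 2 * τ * ⟪c, p⟫ + τ ^ 2 * (c 0 ^ 2 + c 1 ^ 2) := by
    rw [norm_add_sq_real, norm_smul, mul_pow, inner_smul_right, real_inner_comm,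
      EuclideanSpace.real_norm_sq_eq c, Fin.sum_univ_two]
    simp
    ring
  rw [hn]
  simp only [map_add, map_sub, map_smul, Fin.sum_univ_two, add_apply, sub_apply,
    smul_apply, planeFourier_lineDerivOp, smul_eq_mul, inner_basisVec]
  push_cast
  ring_nf
  simp [I_sq]

theorem integral_planeFourier_symbol (g : 𝓢(Plane, ℂ)) (α β : ℂ) (τ : ℝ) (p r : Plane) :
    ∫ c, planeFourier g c * (α + ((‖p + τ • c‖ ^ 2 : ℝ) : ℂ) * β) * exp (I * (⟪c, r⟫ : ℝ)) =
      ((2 * Real.pi) ^ 2 : ℝ) * (α * g r + β * ((‖p‖ ^ 2 : ℝ) * g r - 2 * I * τ * (∂_{p} g) r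
        - (τ : ℂ) ^ 2 * ∑ j : Fin 2,
          (∂_{basisVec j} (∂_{basisVec j} g)) r)) := by
  simp_rw [planeFourier_symbol]
  rw [integral_planeFourier_mul_exp]
  simp only [add_apply, sub_apply, smul_apply, sum_apply, smul_eq_mul]

/-! ### Slices and the partial Fourier transform -/

theorem norm_iteratedFDeriv_slice_le (K : 𝓢(PhaseSpace, ℂ)) (l : ℕ) (r y : Plane) :
    ‖iteratedFDeriv ℝ l (fun y : Plane => K (r, y)) y‖ ≤ ‖iteratedFDeriv ℝ l K (r, y)‖ := by
  have h1 : (fun y : Plane => K (r, y))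
      = (fun z => K (z + (r, 0))) ∘ ContinuousLinearMap.inr ℝ Plane Plane := by
    funext y
    simp
  have hs : ContDiff ℝ ((⊤ : ℕ∞) : WithTop ℕ∞) fun z => K (z + (r, 0)) :=
    (K.smooth ⊤).comp (contDiff_id.add contDiff_const)
  rw [h1, (ContinuousLinearMap.inr ℝ Plane Plane).iteratedFDeriv_comp_right hs y
    (by exact_mod_cast le_top), iteratedFDeriv_comp_add_right]
  refine (ContinuousMultilinearMap.norm_compContinuousLinearMap_le _ _).trans ?_
  rw [Finset.prod_const]
  have h2 : (ContinuousLinearMap.inr ℝ Plane Plane) y + (r, 0) = (r, y) := by simp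
  rw [h2]
  refine mul_le_of_le_one_right (norm_nonneg _) (pow_le_one₀ (norm_nonneg _) ?_)
  exact ContinuousLinearMap.norm_inr_le_one ℝ Plane Plane

theorem exists_slice_decay (K : 𝓢(PhaseSpace, ℂ)) (N k l : ℕ) : ∃ C : ℝ, 0 ≤ C ∧ ∀ r y : Plane,
    (1 + ‖r‖) ^ N * (‖y‖ ^ k * ‖iteratedFDeriv ℝ l (fun y : Plane => K (r, y)) y‖) ≤ C := by
  -- The weight of order N + k is shared out: N powers control r and k powers control y.
  have h := SchwartzMap.one_add_le_sup_seminorm_apply (𝕜 := ℝ) (m := (N + k, l)) le_rfl le_rfl K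
  refine ⟨_, le_trans (by positivity) (h 0), fun r y => le_trans ?_ (h (r, y))⟩
  rw [pow_add, mul_assoc]
  have hr : ‖r‖ ≤ ‖((r, y) : PhaseSpace)‖ := norm_fst_le (r, y)
  have hy : ‖y‖ ≤ 1 + ‖((r, y) : PhaseSpace)‖ := (norm_snd_le (r, y)).trans (by linarith)
  gcongr
  exact norm_iteratedFDeriv_slice_le K l r y

/-- The Schwartz function `y ↦ K (r, y)`. -/
def slice (K : 𝓢(PhaseSpace, ℂ)) (r : Plane) : 𝓢(Plane, ℂ) where
  toFun y := K (r, y)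
  smooth' := (K.smooth ⊤).comp (contDiff_const.prodMk contDiff_id)
  decay' k l := by
    obtain ⟨C, -, hC⟩ := exists_slice_decay K 0 k l
    exact ⟨C, fun y => by simpa using hC r y⟩

@[simp]
theorem slice_apply (K : 𝓢(PhaseSpace, ℂ)) (r y : Plane) : slice K r y = K (r, y) := rfl

theorem exists_seminorm_slice_le (K : 𝓢(PhaseSpace, ℂ)) (N k l : ℕ) : ∃ C : ℝ, ∀ r : Plane,
    (1 + ‖r‖) ^ N * SchwartzMap.seminorm ℝ k l (slice K r) ≤ C := by
  obtain ⟨C, hC0, hC⟩ := exists_slice_decay K N k l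
  refine ⟨C, fun r => ?_⟩
  have hpos : 0 < (1 + ‖r‖) ^ N := by positivity
  rw [← le_div_iff₀' hpos]
  refine SchwartzMap.seminorm_le_bound ℝ k l _ (by positivity) fun y => ?_
  rw [le_div_iff₀' hpos]
  exact hC r y

theorem slice_lineDerivOp (K : 𝓢(PhaseSpace, ℂ)) (r v : Plane) :
    slice (∂_{((0, v) : PhaseSpace)} K) r = ∂_{v} (slice K r) := by
  ext y
  rw [slice_apply, SchwartzMap.lineDerivOp_apply_eq_fderiv, SchwartzMap.lineDerivOp_apply_eq_fderiv]
  have h : HasFDerivAt (fun y : Plane => K (r, y))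
      ((fderiv ℝ K (r, y)).comp (ContinuousLinearMap.inr ℝ Plane Plane)) y :=
    (K.hasFDerivAt (r, y)).comp y (hasFDerivAt_prodMk_right r y)
  have h3 : fderiv ℝ (slice K r) y = _ := h.fderiv
  rw [h3]
  simp

/-- The Fourier transform of `K` in the second variable. -/
def partialFourier (K : 𝓢(PhaseSpace, ℂ)) (x : PhaseSpace) : ℂ :=
  planeFourier (slice K x.1) x.2

theorem stronglyMeasurable_partialFourier (K : 𝓢(PhaseSpace, ℂ)) :
    StronglyMeasurable (partialFourier K) := by
  have h : partialFourier K = fun x => ∫ y, K (x.1, y) * exp (-I * (⟪x.2, y⟫ : ℝ)) := by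
    funext x
    rw [partialFourier, planeFourier_apply]
    rfl
  rw [h]
  refine StronglyMeasurable.integral_prod_right
    (f := fun (x : PhaseSpace) (y : Plane) => K (x.1, y) * exp (-I * (⟪x.2, y⟫ : ℝ))) ?_
  refine Continuous.stronglyMeasurable ?_
  have := K.continuous
  fun_prop

theorem one_add_pow_le {t : ℝ} (ht : 0 ≤ t) (N : ℕ) : (1 + t) ^ N ≤ 2 ^ N * (1 + t ^ N) := by
  refine (add_pow_le zero_le_one ht N).trans ?_
  rw [one_pow]
  gcongr
  · norm_num
  · omega

/-- Decay in the frequency comes from continuity of the Fourier transform on Schwartz space, with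
constants independent of r; decay in r is inherited from the seminorms of the slices. -/
theorem exists_partialFourier_decay (K : 𝓢(PhaseSpace, ℂ)) (N : ℕ) : ∃ C : ℝ, ∀ x : PhaseSpace,
    (1 + ‖x.1‖) ^ N * (1 + ‖x.2‖) ^ N * ‖partialFourier K x‖ ≤ C := by
  have key : ∀ k : ℕ, ∃ C : ℝ, ∀ x : PhaseSpace,
      (1 + ‖x.1‖) ^ N * (‖x.2‖ ^ k * ‖partialFourier K x‖) ≤ C := by
    intro k
    obtain ⟨s, A, hA, hle⟩ := exists_seminorm_le_sum (planeFourier.restrictScalars ℝ) k 0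
    choose B hB using exists_seminorm_slice_le K N
    refine ⟨A * ∑ i ∈ s, B i.1 i.2, fun x => ?_⟩
    have h1 : ‖x.2‖ ^ k * ‖partialFourier K x‖
        ≤ A * ∑ i ∈ s, SchwartzMap.seminorm ℝ i.1 i.2 (slice K x.1) :=
      ((planeFourier (slice K x.1)).norm_pow_mul_le_seminorm ℝ k x.2).trans (hle _)
    refine (mul_le_mul_of_nonneg_left h1 (by positivity)).trans ?_
    rw [mul_left_comm, Finset.mul_sum]
    exact mul_le_mul_of_nonneg_left (Finset.sum_le_sum fun i _ => hB i.1 i.2 x.1) hA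
  obtain ⟨C₀, h₀⟩ := key 0
  obtain ⟨C₁, h₁⟩ := key N
  refine ⟨2 ^ N * (C₀ + C₁), fun x => ?_⟩
  calc (1 + ‖x.1‖) ^ N * (1 + ‖x.2‖) ^ N * ‖partialFourier K x‖
      ≤ (1 + ‖x.1‖) ^ N * (2 ^ N * (1 + ‖x.2‖ ^ N)) * ‖partialFourier K x‖ := by
        gcongr
        exact one_add_pow_le (norm_nonneg _) N
    _ = 2 ^ N * ((1 + ‖x.1‖) ^ N * (‖x.2‖ ^ 0 * ‖partialFourier K x‖)
        + (1 + ‖x.1‖) ^ N * (‖x.2‖ ^ N * ‖partialFourier K x‖)) := by ring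
    _ ≤ _ := by
        gcongr
        · exact h₀ x
        · exact h₁ x

/-! ### Integrability from polynomial decay -/

theorem integrable_one_add_norm_plane :
    Integrable fun r : Plane => ((1 + ‖r‖) ^ 3)⁻¹ := by
  have h := integrable_one_add_norm (E := Plane) (μ := volume) (r := 3)
    (by rw [finrank_euclideanSpace_fin]; norm_num)
  refine h.congr (Filter.Eventually.of_forall fun r => ?_)
  have : (0 : ℝ) ≤ 1 + ‖r‖ := by positivity
  simp only [Real.rpow_neg this]
  congr 1
  exact_mod_cast Real.rpow_natCast (1 + ‖r‖) 3

theorem integrable_of_decay {g : PhaseSpace → ℂ} (hg : AEStronglyMeasurable g) {C : ℝ}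
    (hC : ∀ x, (1 + ‖x.1‖) ^ 3 * (1 + ‖x.2‖) ^ 3 * ‖g x‖ ≤ C) : Integrable g := by
  have h := (integrable_one_add_norm_plane.mul_prod integrable_one_add_norm_plane).const_mul C
  refine h.mono' hg (Filter.Eventually.of_forall fun x => ?_)
  have h1 := hC x
  have h2 : 0 < (1 + ‖x.1‖) ^ 3 * (1 + ‖x.2‖) ^ 3 := by positivity
  rw [← mul_inv, ← div_eq_mul_inv, le_div_iff₀' h2]
  exact h1

/-- Exchange of the two variables. -/
def swapSchwartz : 𝓢(PhaseSpace, ℂ) →L[ℂ] 𝓢(PhaseSpace, ℂ) :=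
  SchwartzMap.compCLMOfContinuousLinearEquiv ℂ (ContinuousLinearEquiv.prodComm ℝ Plane Plane)

theorem swapSchwartz_apply (K : 𝓢(PhaseSpace, ℂ)) (x y : Plane) :
    swapSchwartz K (x, y) = K (y, x) := rfl

theorem lineDerivOp_slice_swapSchwartz (K : 𝓢(PhaseSpace, ℂ)) (y v : Plane) :
    ∂_{v} (slice (swapSchwartz K) y) = slice (swapSchwartz (∂_{((v, 0) : PhaseSpace)} K)) y := by
  rw [← slice_lineDerivOp, swapSchwartz, SchwartzMap.lineDerivOp_compCLMOfContinuousLinearEquiv]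
  rfl

/-! ### The Moyal product of a quadratic Hamiltonian and a Wigner function -/

theorem one_add_norm_le_of_smul {c : ℝ} (hc : c ≠ 0) (y : Plane) :
    1 + ‖y‖ ≤ (1 + |c|⁻¹) * (1 + ‖c • y‖) := by
  have hc' : 0 < |c| := abs_pos.2 hc
  rw [norm_smul, Real.norm_eq_abs]
  have h : (1 + |c|⁻¹) * (1 + |c| * ‖y‖) = 1 + ‖y‖ + |c|⁻¹ + |c| * ‖y‖ := by
    field_simp
    ring
  rw [h]
  have : 0 ≤ |c|⁻¹ := by positivity
  have : 0 ≤ |c| * ‖y‖ := by positivity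
  linarith

theorem one_add_norm_prod_le (x : PhaseSpace) : 1 + ‖x‖ ≤ (1 + ‖x.1‖) * (1 + ‖x.2‖) := by
  have h1 := norm_nonneg x.1
  have h2 := norm_nonneg x.2
  have h3 : ‖x‖ ≤ ‖x.1‖ + ‖x.2‖ := by
    rw [Prod.norm_def]
    exact max_le (by linarith) (by linarith)
  nlinarith [mul_nonneg h1 h2]

theorem integrable_partialFourier_mul (K : 𝓢(PhaseSpace, ℂ)) {a b : ℝ} (ha : a ≠ 0) (hb : b ≠ 0)
    {m : PhaseSpace → ℂ} (hm : Continuous m) {C : ℝ} {N : ℕ}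
    (hC : ∀ x, ‖m x‖ ≤ C * (1 + ‖x‖) ^ N) :
    Integrable fun x : PhaseSpace => partialFourier K (a • x.1, b • x.2) * m x := by
  -- N powers absorb the growth of m; the other three exceed the dimension of each plane and give
  -- integrability.
  obtain ⟨D, hD⟩ := exists_partialFourier_decay K (N + 3)
  have hC0 : 0 ≤ C := by simpa using (norm_nonneg _).trans (hC 0)
  refine integrable_of_decay (C := C * ((1 + |a|⁻¹) ^ (N + 3) * (1 + |b|⁻¹) ^ (N + 3) * D)) ?_
    fun x => ?_
  · refine (StronglyMeasurable.mul ?_ hm.stronglyMeasurable).aestronglyMeasurable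
    refine (stronglyMeasurable_partialFourier K).comp_measurable
      (g := fun x : PhaseSpace => (a • x.1, b • x.2)) ?_
    exact Continuous.measurable (by fun_prop)
  · set F := ‖partialFourier K (a • x.1, b • x.2)‖
    have hx := one_add_norm_prod_le x
    have h1 := one_add_norm_le_of_smul ha x.1
    have h2 := one_add_norm_le_of_smul hb x.2
    rw [norm_mul]
    calc (1 + ‖x.1‖) ^ 3 * (1 + ‖x.2‖) ^ 3 * (F * ‖m x‖)
        ≤ (1 + ‖x.1‖) ^ 3 * (1 + ‖x.2‖) ^ 3 * (F * (C * ((1 + ‖x.1‖) * (1 + ‖x.2‖)) ^ N)) := by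
          gcongr
          exact (hC x).trans (by gcongr)
      _ = C * ((1 + ‖x.1‖) ^ (N + 3) * (1 + ‖x.2‖) ^ (N + 3) * F) := by
          rw [mul_pow]
          generalize 1 + ‖x.1‖ = s
          generalize 1 + ‖x.2‖ = t
          ring
      _ ≤ C * (((1 + |a|⁻¹) * (1 + ‖a • x.1‖)) ^ (N + 3)
          * ((1 + |b|⁻¹) * (1 + ‖b • x.2‖)) ^ (N + 3) * F) := by gcongr
      _ = C * ((1 + |a|⁻¹) ^ (N + 3) * (1 + |b|⁻¹) ^ (N + 3) *
          ((1 + ‖a • x.1‖) ^ (N + 3) * (1 + ‖b • x.2‖) ^ (N + 3) * F)) := by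
          rw [mul_pow, mul_pow]
          ac_rfl
      _ ≤ _ := by
          gcongr
          exact hD (a • x.1, b • x.2)

/-- The Wigner function of the kernel with value `K (r, Δ)` at the pair `r ∓ Δ / 2`, as a function
of position and of the momentum `p = ħ q`. -/
def scaledWigner (ħ : ℝ) (K : 𝓢(PhaseSpace, ℂ)) (x : PhaseSpace) : ℂ :=
  (1 / (2 * Real.pi) ^ 2 : ℝ) * planeFourier (slice K x.1) (ħ⁻¹ • x.2)

theorem continuous_planeWave_right (ξ : PhaseSpace) : Continuous (planeWave ξ) := by
  unfold planeWave
  fun_prop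

theorem continuous_planeWave_left (x : PhaseSpace) : Continuous fun ξ => planeWave ξ x := by
  unfold planeWave
  fun_prop

theorem norm_planeWave (ξ x : PhaseSpace) : ‖planeWave ξ x‖ = 1 := by
  rw [planeWave, mul_comm, norm_exp_ofReal_mul_I]

theorem integrable_scaledWigner_mul {ħ : ℝ} (hħ : ħ ≠ 0) (K : 𝓢(PhaseSpace, ℂ))
    {m : PhaseSpace → ℂ} (hm : Continuous m) (hm1 : ∀ x, ‖m x‖ = 1) :
    Integrable fun x => scaledWigner ħ K x * m x := by
  have h := (integrable_partialFourier_mul K one_ne_zero (inv_ne_zero hħ) hm (C := 1) (N := 0)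
    fun x => by simp [hm1]).const_mul ((1 / (2 * Real.pi) ^ 2 : ℝ) : ℂ)
  refine h.congr (Filter.Eventually.of_forall fun x => ?_)
  simp only [scaledWigner, partialFourier, one_smul]
  ring

theorem integrable_scaledWigner {ħ : ℝ} (hħ : ħ ≠ 0) (K : 𝓢(PhaseSpace, ℂ)) :
    Integrable (scaledWigner ħ K) := by
  simpa using integrable_scaledWigner_mul hħ K (m := fun _ => 1) continuous_const (by simp)

/-- The integral over p undoes the Fourier transform in Δ and evaluates K at Δ = -ħd, where ξ = (c,
d); the integral over r is then a Fourier transform in the first variable. -/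
theorem phaseFourier_scaledWigner {ħ : ℝ} (hħ : ħ ≠ 0) (K : 𝓢(PhaseSpace, ℂ)) (ξ : PhaseSpace) :
    phaseFourier (scaledWigner ħ K) ξ = ((1 / (2 * Real.pi) ^ 4 * ħ ^ 2 : ℝ) : ℂ) *
      partialFourier (swapSchwartz K) (-ħ • ξ.2, ξ.1) := by
  have hint : Integrable fun x => scaledWigner ħ K x * planeWave ξ (-x) :=
    integrable_scaledWigner_mul hħ K ((continuous_planeWave_right ξ).comp continuous_neg)
      fun x => norm_planeWave _ _
  have hinner : ∀ r : Plane, ∫ p : Plane, scaledWigner ħ K (r, p) * planeWave ξ (-(r, p))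
      = (ħ ^ 2 : ℝ) * (K (r, -ħ • ξ.2) * exp (-I * (⟪ξ.1, r⟫ : ℝ))) := by
    intro r
    have h1 : ∀ p : Plane, scaledWigner ħ K (r, p) * planeWave ξ (-(r, p))
        = ((1 / (2 * Real.pi) ^ 2 : ℝ) * exp (-I * (⟪ξ.1, r⟫ : ℝ))) *
          (fun q : Plane => planeFourier (slice K r) q * exp (I * (⟪q, -ħ • ξ.2⟫ : ℝ)))
            (ħ⁻¹ • p) := by
      intro p
      have h2 : planeWave ξ (-(r, p)) = exp (-I * (⟪ξ.1, r⟫ : ℝ)) *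
          exp (I * (⟪ħ⁻¹ • p, -ħ • ξ.2⟫ : ℝ)) := by
        rw [planeWave, ← exp_add, inner_smul_left, inner_smul_right,
          real_inner_comm ξ.2 p]
        congr 1
        have : (ħ : ℂ) ≠ 0 := by exact_mod_cast hħ
        simp
        field_simp
      rw [h2, scaledWigner]
      ring
    rw [integral_congr_ae (Filter.Eventually.of_forall h1), integral_const_mul,
      integral_comp_smul_plane (fun q : Plane => planeFourier (slice K r) q *
        exp (I * (⟪q, -ħ • ξ.2⟫ : ℝ))), integral_planeFourier_mul_exp, slice_apply]
    have : (Real.pi : ℂ) ≠ 0 := by exact_mod_cast Real.pi_ne_zero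
    push_cast
    field_simp
  rw [phaseFourier, Measure.volume_eq_prod, integral_prod _ hint]
  simp_rw [hinner]
  rw [integral_const_mul, partialFourier, planeFourier_apply]
  simp only [slice_apply, swapSchwartz_apply]
  push_cast
  ring

theorem integrable_phaseFourier_scaledWigner_mul {ħ : ℝ} (hħ : ħ ≠ 0) (K : 𝓢(PhaseSpace, ℂ))
    {m : PhaseSpace → ℂ} (hm : Continuous m) {C : ℝ} {N : ℕ}
    (hC : ∀ x, ‖m x‖ ≤ C * (1 + ‖x‖) ^ N) :
    Integrable fun ξ => phaseFourier (scaledWigner ħ K) ξ * m ξ := by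
  have h := (integrable_partialFourier_mul (swapSchwartz K) (neg_ne_zero.2 hħ) one_ne_zero
    (hm.comp continuous_swap) (C := C) (N := N) fun x => (hC x.swap).trans_eq (by
      rw [Prod.norm_def, Prod.norm_def, Prod.fst_swap, Prod.snd_swap, max_comm]))
  have h2 := (h.swap).const_mul ((1 / (2 * Real.pi) ^ 4 * ħ ^ 2 : ℝ) : ℂ)
  refine h2.congr (Filter.Eventually.of_forall fun ξ => ?_)
  simp only [phaseFourier_scaledWigner hħ, Function.comp_apply, Prod.swap_swap, Prod.fst_swap,
    Prod.snd_swap, one_smul]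
  ring

/-- The shifted point is affine in ξ, so the translated symbol grows polynomially in ξ, against the
rapid decay of the Fourier transform of the Wigner function. -/
theorem integrable_expPoissonIntegrand {ħ : ℝ} (hħ : ħ ≠ 0) (K : 𝓢(PhaseSpace, ℂ)) (τ : ℝ)
    {A : PhaseSpace → ℂ} (hA : A.HasTemperateGrowth) (x : PhaseSpace) :
    Integrable (expPoissonIntegrand τ A (scaledWigner ħ K) x) := by
  let S : PhaseSpace →L[ℝ] PhaseSpace :=
    (-(τ • ContinuousLinearMap.snd ℝ Plane Plane)).prod (τ • ContinuousLinearMap.fst ℝ Plane Plane)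
  have hS : ∀ ξ, poissonShift τ ξ x = x + S ξ := fun ξ => by
    simp [poissonShift, S, Prod.ext_iff, sub_eq_add_neg]
  have hshift : (fun ξ => A (poissonShift τ ξ x)).HasTemperateGrowth := by
    simp_rw [hS]
    exact hA.comp ((Function.HasTemperateGrowth.const x).add S.hasTemperateGrowth)
  obtain ⟨N, C, hC⟩ := hshift.2 0
  refine integrable_phaseFourier_scaledWigner_mul hħ K (C := C) (N := N)
    (hshift.1.continuous.mul (continuous_planeWave_left x)) fun ξ => ?_
  rw [norm_mul, norm_planeWave, mul_one]
  simpa using hC ξ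

/-- Multiplication of `K (r, Δ)` by `g (r + Δ / 2)`. -/
def mulShift (g : Plane → ℂ) : 𝓢(PhaseSpace, ℂ) →L[ℂ] 𝓢(PhaseSpace, ℂ) :=
  SchwartzMap.smulLeftCLM ℂ fun x => g (shiftCLM (1 / 2) x)

theorem hasTemperateGrowth_comp_shiftCLM {g : Plane → ℂ} (hg : g.HasTemperateGrowth) (c : ℝ) :
    (fun x => g (shiftCLM c x)).HasTemperateGrowth :=
  hg.comp (shiftCLM c).hasTemperateGrowth

theorem mulShift_apply {g : Plane → ℂ} (hg : g.HasTemperateGrowth) (K : 𝓢(PhaseSpace, ℂ))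
    (x : PhaseSpace) : mulShift g K x = g (shiftCLM (1 / 2) x) * K x :=
  SchwartzMap.smulLeftCLM_apply_apply (hasTemperateGrowth_comp_shiftCLM hg _) K x

/-- The kernel of the Moyal product of `a(r) + |p|² b(r)` and the Wigner function of `K`, at the
momentum `p`. -/
def moyalKernel (ħ : ℝ) (a b : Plane → ℂ) (p : Plane) (K : 𝓢(PhaseSpace, ℂ)) : 𝓢(PhaseSpace, ℂ) :=
  mulShift a K + mulShift b (((‖p‖ ^ 2 : ℝ) : ℂ) • K - (I * ħ) • ∂_{((p, 0) : PhaseSpace)} K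
    - ((ħ : ℂ) ^ 2 / 4) • ∑ j : Fin 2, ∂_{((basisVec j, 0) : PhaseSpace)}
      (∂_{((basisVec j, 0) : PhaseSpace)} K))

theorem hasTemperateGrowth_quadratic {a b : Plane → ℂ} (ha : a.HasTemperateGrowth)
    (hb : b.HasTemperateGrowth) :
    (fun x : PhaseSpace => a x.1 + ((‖x.2‖ ^ 2 : ℝ) : ℂ) * b x.1).HasTemperateGrowth := by
  have hfst := (ContinuousLinearMap.fst ℝ Plane Plane).hasTemperateGrowth
  have hsnd := (ContinuousLinearMap.snd ℝ Plane Plane).hasTemperateGrowth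
  refine (ha.comp hfst).add (Function.HasTemperateGrowth.mul ?_ (hb.comp hfst))
  exact Function.Complex.hasTemperateGrowth_ofReal.comp
    ((Function.hasTemperateGrowth_norm_sq Plane).comp hsnd)

/-- For fixed d the integral over c is a Fourier inversion at r with a quadratic symbol in c. The
substitution Δ = -ħd then turns r - ħd/2 into r + Δ/2 and the integral over d into the Fourier
integral of a Wigner function. -/
theorem expPoisson_scaledWigner {ħ : ℝ} (hħ : ħ ≠ 0) (K : 𝓢(PhaseSpace, ℂ)) {a b : Plane → ℂ}
    (ha : a.HasTemperateGrowth) (hb : b.HasTemperateGrowth) (x : PhaseSpace) :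
    expPoisson (ħ / 2) (fun x => a x.1 + ((‖x.2‖ ^ 2 : ℝ) : ℂ) * b x.1) (scaledWigner ħ K) x
      = scaledWigner ħ (moyalKernel ħ a b x.2 K) x := by
  obtain ⟨r, p⟩ := x
  have hint := integrable_expPoissonIntegrand hħ K (ħ / 2) (hasTemperateGrowth_quadratic ha hb)
    (r, p)
  have hπ : (Real.pi : ℂ) ≠ 0 := by exact_mod_cast Real.pi_ne_zero
  have hħ' : (ħ : ℂ) ≠ 0 := by exact_mod_cast hħ
  have hinner : ∀ d : Plane, ∫ c : Plane, expPoissonIntegrand (ħ / 2)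
      (fun x => a x.1 + ((‖x.2‖ ^ 2 : ℝ) : ℂ) * b x.1) (scaledWigner ħ K) (r, p) (c, d)
      = ((1 / (2 * Real.pi) ^ 2 * ħ ^ 2 : ℝ) : ℂ) *
        (fun y : Plane => slice (moyalKernel ħ a b p K) r y * exp (-I * (⟪ħ⁻¹ • p, y⟫ : ℝ)))
          (-ħ • d) := by
    intro d
    have h1 : ∀ c : Plane, expPoissonIntegrand (ħ / 2)
        (fun x => a x.1 + ((‖x.2‖ ^ 2 : ℝ) : ℂ) * b x.1) (scaledWigner ħ K) (r, p) (c, d)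
        = ((1 / (2 * Real.pi) ^ 4 * ħ ^ 2 : ℝ) : ℂ) * exp (I * (⟪d, p⟫ : ℝ)) *
          (planeFourier (slice (swapSchwartz K) (-ħ • d)) c *
            (a (r - (ħ / 2) • d) + ((‖p + (ħ / 2) • c‖ ^ 2 : ℝ) : ℂ) * b (r - (ħ / 2) • d)) *
            exp (I * (⟪c, r⟫ : ℝ))) := by
      intro c
      simp only [expPoissonIntegrand, phaseFourier_scaledWigner hħ, poissonShift, planeWave,
        partialFourier]
      rw [ofReal_add, mul_add, exp_add]
      ring
    rw [integral_congr_ae (Filter.Eventually.of_forall h1), integral_const_mul,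
      integral_planeFourier_symbol]
    have h2 : exp (-I * (⟪ħ⁻¹ • p, -ħ • d⟫ : ℝ)) = exp (I * (⟪d, p⟫ : ℝ)) := by
      rw [inner_smul_left, inner_smul_right, real_inner_comm]
      congr 1
      simp
      field_simp
    have h3 : shiftCLM (1 / 2) (r, -ħ • d) = r - (ħ / 2) • d := by
      simp only [shiftCLM_apply]
      module
    simp only [lineDerivOp_slice_swapSchwartz, slice_apply, swapSchwartz_apply, moyalKernel,
      add_apply, sub_apply, smul_apply, sum_apply, mulShift_apply ha, mulShift_apply hb, h2, h3,
      smul_eq_mul]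
    push_cast
    field_simp
    ring
  rw [expPoisson, Measure.volume_eq_prod, integral_prod_symm _ hint]
  simp_rw [hinner]
  rw [integral_const_mul, integral_comp_smul_plane (fun y : Plane =>
    slice (moyalKernel ħ a b p K) r y * exp (-I * (⟪ħ⁻¹ • p, y⟫ : ℝ))), scaledWigner,
    planeFourier_apply]
  push_cast
  field_simp

/-! ### The quantized Hamiltonian -/

/-- The `j`-th partial derivative of a function on the plane. -/
def pderiv (j : Fin 2) (g : Plane → ℂ) (r : Plane) : ℂ := fderiv ℝ g r (basisVec j)

theorem hasTemperateGrowth_pderiv {g : Plane → ℂ} (hg : g.HasTemperateGrowth) (j : Fin 2) :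
    (pderiv j g).HasTemperateGrowth :=
  hasTemperateGrowth_fderiv_apply hg _

/-- The Weyl quantization of `a(r) + |p|² b(r)`, as a differential operator. -/
def hamiltonOp (ħ : ℝ) (a b : Plane → ℂ) : 𝓢(Plane, ℂ) →L[ℂ] 𝓢(Plane, ℂ) :=
  SchwartzMap.smulLeftCLM ℂ a - ((ħ : ℂ) ^ 2) • ∑ j : Fin 2,
    (SchwartzMap.smulLeftCLM ℂ b ∘L LineDeriv.lineDerivOpCLM ℂ 𝓢(Plane, ℂ) (basisVec j) ∘L
        LineDeriv.lineDerivOpCLM ℂ 𝓢(Plane, ℂ) (basisVec j)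
      + SchwartzMap.smulLeftCLM ℂ (pderiv j b) ∘L LineDeriv.lineDerivOpCLM ℂ 𝓢(Plane, ℂ) (basisVec j)
      + (1 / 4 : ℂ) • SchwartzMap.smulLeftCLM ℂ (pderiv j (pderiv j b)))

theorem hamiltonOp_apply {ħ : ℝ} {a b : Plane → ℂ} (ha : a.HasTemperateGrowth)
    (hb : b.HasTemperateGrowth) (u : 𝓢(Plane, ℂ)) (r : Plane) :
    hamiltonOp ħ a b u r = a r * u r - (ħ : ℂ) ^ 2 * ∑ j : Fin 2,
      (b r * (∂_{basisVec j} (∂_{basisVec j} u)) r + pderiv j b r * (∂_{basisVec j} u) r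
        + 1 / 4 * (pderiv j (pderiv j b) r * u r)) := by
  have hb1 := hasTemperateGrowth_pderiv hb
  have hb2 := fun j => hasTemperateGrowth_pderiv (hb1 j) j
  simp only [hamiltonOp, sub_apply, smul_apply, sum_apply, add_apply,
    ContinuousLinearMap.comp_apply, LineDeriv.lineDerivOpCLM_apply, smul_eq_mul,
    SchwartzMap.smulLeftCLM_apply_apply ha, SchwartzMap.smulLeftCLM_apply_apply hb,
    SchwartzMap.smulLeftCLM_apply_apply (hb1 _), SchwartzMap.smulLeftCLM_apply_apply (hb2 _)]

/-- The direction in phase space `(r, Δ)` that moves `r + Δ / 2` along the `j`-th basis vector and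
fixes `r - Δ / 2`. -/
def rightDir (j : Fin 2) : PhaseSpace := ((1 / 2 : ℝ) • basisVec j, basisVec j)

/-- The operator `hamiltonOp` acting on the variable `r + Δ / 2` of the kernel `K (r, Δ)`. -/
def hamiltonKernel (ħ : ℝ) (a b : Plane → ℂ) (K : 𝓢(PhaseSpace, ℂ)) : 𝓢(PhaseSpace, ℂ) :=
  mulShift a K - ((ħ : ℂ) ^ 2) • ∑ j : Fin 2, (mulShift b (∂_{rightDir j} (∂_{rightDir j} K))
    + mulShift (pderiv j b) (∂_{rightDir j} K)
    + (1 / 4 : ℂ) • mulShift (pderiv j (pderiv j b)) K)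

theorem lineDerivOp_mulShift {g : Plane → ℂ} (hg : g.HasTemperateGrowth) (j : Fin 2)
    (K : 𝓢(PhaseSpace, ℂ)) : ∂_{((0, basisVec j) : PhaseSpace)} (mulShift g K)
      = mulShift g (∂_{((0, basisVec j) : PhaseSpace)} K)
        + (1 / 2 : ℂ) • mulShift (pderiv j g) K := by
  rw [mulShift, lineDerivOp_smulLeftCLM (hasTemperateGrowth_comp_shiftCLM hg _)]
  congr 1
  ext x
  have hd : HasFDerivAt (fun x => g (shiftCLM (1 / 2) x))
      ((fderiv ℝ g (shiftCLM (1 / 2) x)).comp (shiftCLM (1 / 2))) x :=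
    HasFDerivAt.comp x (hg.1.differentiable (by simp) _).hasFDerivAt
      (shiftCLM (1 / 2)).hasFDerivAt
  rw [smul_apply, mulShift_apply (hasTemperateGrowth_pderiv hg j),
    SchwartzMap.smulLeftCLM_apply_apply (hasTemperateGrowth_fderiv_apply
      (hasTemperateGrowth_comp_shiftCLM hg _) _), hd.fderiv, pderiv]
  have h0 : shiftCLM (1 / 2) ((0, basisVec j) : PhaseSpace) = (1 / 2 : ℝ) • basisVec j := by simp
  simp only [ContinuousLinearMap.comp_apply, h0, map_smul, smul_eq_mul, real_smul]
  push_cast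
  ring

theorem lineDerivOp_rightDir (j : Fin 2) (K : 𝓢(PhaseSpace, ℂ)) :
    ∂_{rightDir j} K = (1 / 2 : ℂ) • ∂_{((basisVec j, 0) : PhaseSpace)} K
      + ∂_{((0, basisVec j) : PhaseSpace)} K := by
  ext x
  have h : rightDir j = (1 / 2 : ℝ) • ((basisVec j, 0) : PhaseSpace) + (0, basisVec j) := by
    simp [rightDir]
  rw [add_apply, smul_apply]
  simp only [SchwartzMap.lineDerivOp_apply_eq_fderiv, h, map_add, map_smul, real_smul, smul_eq_mul]
  push_cast
  ring

/-- The linear functional `K ↦ ∫ K (r, Δ) exp (-i q · Δ) dΔ`. -/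
def sliceFourier (r q : Plane) : 𝓢(PhaseSpace, ℂ) →ₗ[ℂ] ℂ where
  toFun K := planeFourier (slice K r) q
  map_add' K L := by
    rw [show slice (K + L) r = slice K r + slice L r from rfl, map_add, add_apply]
  map_smul' c K := by
    rw [show slice (c • K) r = c • slice K r from rfl, map_smul, smul_apply, RingHom.id_apply]

theorem sliceFourier_lineDerivOp (K : 𝓢(PhaseSpace, ℂ)) (r v q : Plane) :
    sliceFourier r q (∂_{((0, v) : PhaseSpace)} K) = I * (⟪q, v⟫ : ℝ) * sliceFourier r q K := by
  change planeFourier (slice (∂_{((0, v) : PhaseSpace)} K) r) q = _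
  rw [slice_lineDerivOp, planeFourier_lineDerivOp]
  rfl

/-- All Δ-derivatives are moved outside the multiplications, where the Fourier transform in Δ makes
them scalars. As b is evaluated at r + Δ/2, each Δ-derivative falling on it costs a factor 1/2; this
produces the Weyl coefficients 1 and 1/4 of b' and b''. -/
theorem lineDerivOp_mulShift_expand {b : Plane → ℂ} (hb : b.HasTemperateGrowth) (j : Fin 2)
    (K : 𝓢(PhaseSpace, ℂ)) :
    mulShift b (∂_{rightDir j} (∂_{rightDir j} K)) + mulShift (pderiv j b) (∂_{rightDir j} K)
      + (1 / 4 : ℂ) • mulShift (pderiv j (pderiv j b)) K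
    = ∂_{((0, basisVec j) : PhaseSpace)} (∂_{((0, basisVec j) : PhaseSpace)} (mulShift b K))
      + ∂_{((0, basisVec j) : PhaseSpace)} (mulShift b (∂_{((basisVec j, 0) : PhaseSpace)} K))
      + (1 / 4 : ℂ) • mulShift b
        (∂_{((basisVec j, 0) : PhaseSpace)} (∂_{((basisVec j, 0) : PhaseSpace)} K)) := by
  have hb1 := hasTemperateGrowth_pderiv hb j
  simp only [lineDerivOp_rightDir, lineDerivOp_mulShift hb, lineDerivOp_mulShift hb1, map_add,
    map_smul, LineDeriv.lineDerivOp_add, LineDeriv.lineDerivOp_smul]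
  rw [lineDerivOp_comm (basisVec j, 0) (0, basisVec j)]
  module

/-- Integration by parts: under the Fourier transform in Δ at frequency p/ħ, the derivative in Δ
along the j-th axis is multiplication by i p_j/ħ. This accounts for every p in the Moyal kernel. -/
theorem scaledWigner_moyalKernel {ħ : ℝ} (hħ : ħ ≠ 0) (a : Plane → ℂ) {b : Plane → ℂ}
    (hb : b.HasTemperateGrowth) (K : 𝓢(PhaseSpace, ℂ)) (x : PhaseSpace) :
    scaledWigner ħ (moyalKernel ħ a b x.2 K) x = scaledWigner ħ (hamiltonKernel ħ a b K) x := by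
  obtain ⟨r, p⟩ := x
  have hħ' : (ħ : ℂ) ≠ 0 := by exact_mod_cast hħ
  have hp : ((p, 0) : PhaseSpace) = p 0 • (basisVec 0, 0) + p 1 • (basisVec 1, 0) := by
    ext i <;> fin_cases i <;> simp [basisVec]
  have hdir : ∂_{((p, 0) : PhaseSpace)} K = (p 0 : ℂ) • ∂_{((basisVec 0, 0) : PhaseSpace)} K
      + (p 1 : ℂ) • ∂_{((basisVec 1, 0) : PhaseSpace)} K := by
    ext y
    simp only [add_apply, smul_apply, SchwartzMap.lineDerivOp_apply_eq_fderiv, hp, map_add,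
      map_smul, real_smul, smul_eq_mul]
  have hin : ∀ j, ⟪ħ⁻¹ • p, basisVec j⟫ = ħ⁻¹ * p j := fun j => by
    rw [inner_smul_left, inner_basisVec]
    rfl
  suffices h : sliceFourier r (ħ⁻¹ • p) (moyalKernel ħ a b p K)
      = sliceFourier r (ħ⁻¹ • p) (hamiltonKernel ħ a b K) by
    simp only [scaledWigner]
    congr 1
  simp only [moyalKernel, hamiltonKernel, lineDerivOp_mulShift_expand hb, hdir,
    EuclideanSpace.real_norm_sq_eq p, Fin.sum_univ_two, map_add, map_sub, map_smul,
    sliceFourier_lineDerivOp, hin, smul_eq_mul]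
  push_cast
  field_simp
  ring_nf
  simp only [I_sq]
  ring

/-! ### Weyl quantization -/

/-- Multiplication of `u(y)` by `g ((r + y) / 2)`. -/
def mulMid (r : Plane) (g : Plane → ℂ) : 𝓢(Plane, ℂ) →L[ℂ] 𝓢(Plane, ℂ) :=
  SchwartzMap.smulLeftCLM ℂ fun y => g ((1 / 2 : ℝ) • (r + y))

theorem hasTemperateGrowth_comp_mid {g : Plane → ℂ} (hg : g.HasTemperateGrowth) (r : Plane) :
    (fun y => g ((1 / 2 : ℝ) • (r + y))).HasTemperateGrowth := by
  refine hg.comp ?_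
  fun_prop

theorem mulMid_apply {g : Plane → ℂ} (hg : g.HasTemperateGrowth) (r : Plane) (u : 𝓢(Plane, ℂ))
    (y : Plane) : mulMid r g u y = g ((1 / 2 : ℝ) • (r + y)) * u y :=
  SchwartzMap.smulLeftCLM_apply_apply (hasTemperateGrowth_comp_mid hg r) u y

theorem lineDerivOp_mulMid {g : Plane → ℂ} (hg : g.HasTemperateGrowth) (r : Plane) (j : Fin 2)
    (u : 𝓢(Plane, ℂ)) : ∂_{basisVec j} (mulMid r g u)
      = mulMid r g (∂_{basisVec j} u) + (1 / 2 : ℂ) • mulMid r (pderiv j g) u := by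
  rw [mulMid, lineDerivOp_smulLeftCLM (hasTemperateGrowth_comp_mid hg r)]
  congr 1
  ext y
  have hl : HasFDerivAt (fun y : Plane => (1 / 2 : ℝ) • (r + y))
      ((1 / 2 : ℝ) • ContinuousLinearMap.id ℝ Plane) y :=
    ((hasFDerivAt_id y).const_add r).const_smul (1 / 2 : ℝ)
  have hd : HasFDerivAt (fun y => g ((1 / 2 : ℝ) • (r + y)))
      ((fderiv ℝ g ((1 / 2 : ℝ) • (r + y))).comp ((1 / 2 : ℝ) • ContinuousLinearMap.id ℝ Plane)) y :=
    HasFDerivAt.comp y (hg.1.differentiable (by simp) _).hasFDerivAt hl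
  rw [smul_apply, mulMid_apply (hasTemperateGrowth_pderiv hg j),
    SchwartzMap.smulLeftCLM_apply_apply (hasTemperateGrowth_fderiv_apply
      (hasTemperateGrowth_comp_mid hg r) _), hd.fderiv, pderiv]
  simp only [ContinuousLinearMap.comp_apply, smul_apply, ContinuousLinearMap.id_apply, map_smul,
    smul_eq_mul, real_smul]
  push_cast
  ring

/-- The integral over y is a Fourier transform, on which |p|² acts as -ħ² times the Laplacian; the
integral over p is Fourier inversion at y = r. The Leibniz rule for b((r + y)/2)u(y), evaluated at y
= r, gives the differential operator. -/
theorem weylOp_quadratic {ħ : ℝ} (hħ : ħ ≠ 0) {a b : Plane → ℂ} (ha : a.HasTemperateGrowth)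
    (hb : b.HasTemperateGrowth) (u : 𝓢(Plane, ℂ)) (r : Plane) :
    weylOp ħ (fun x => a x.1 + ((‖x.2‖ ^ 2 : ℝ) : ℂ) * b x.1) u r = hamiltonOp ħ a b u r := by
  have hħ' : (ħ : ℂ) ≠ 0 := by exact_mod_cast hħ
  have hπ : (Real.pi : ℂ) ≠ 0 := by exact_mod_cast Real.pi_ne_zero
  have hb1 := hasTemperateGrowth_pderiv hb
  have hb2 := fun j => hasTemperateGrowth_pderiv (hb1 j) j
  set γ : 𝓢(Plane, ℂ) := mulMid r a u - ((ħ : ℂ) ^ 2) • ∑ j : Fin 2,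
    ∂_{basisVec j} (∂_{basisVec j} (mulMid r b u)) with hγ
  have hsymb : ∀ q : Plane, planeFourier γ q = planeFourier (mulMid r a u) q
      + ((‖ħ • q‖ ^ 2 : ℝ) : ℂ) * planeFourier (mulMid r b u) q := by
    intro q
    -- With base momentum 0 and τ = ħ the quadratic symbol is exactly |ħq|².
    have h := planeFourier_symbol (mulMid r b u) 0 1 ħ 0 q
    have h0 : (∂_{(0 : Plane)} (mulMid r b u)) = 0 := LineDeriv.lineDerivOp_left_zero _
    simp only [zero_add, mul_one, zero_smul, one_smul, h0, smul_zero, sub_zero, norm_zero] at h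
    rw [mul_comm (((‖ħ • q‖ ^ 2 : ℝ) : ℂ)), h, hγ, map_sub, sub_apply, sub_eq_add_neg]
    congr 1
    norm_num
  have hinner : ∀ p : Plane, ∫ y : Plane, (fun x : PhaseSpace => a x.1 +
      ((‖x.2‖ ^ 2 : ℝ) : ℂ) * b x.1) ((1 / 2 : ℝ) • (r + y), p) *
        exp (I * (⟪p, r - y⟫ / ħ : ℝ)) * u y
      = (fun q : Plane => planeFourier γ q * exp (I * (⟪q, r⟫ : ℝ))) (ħ⁻¹ • p) := by
    intro p
    have hp : ħ • ħ⁻¹ • p = p := by rw [smul_smul, mul_inv_cancel₀ hħ, one_smul]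
    simp only [hsymb, hp, planeFourier_apply]
    rw [← integral_const_mul, ← integral_add (integrable_mul_exp_neg _ _)
      ((integrable_mul_exp_neg _ _).const_mul _),
      ← integral_mul_const]
    congr 1
    ext y
    have h2 : exp (I * (⟪p, r - y⟫ / ħ : ℝ))
        = exp (-I * (⟪ħ⁻¹ • p, y⟫ : ℝ)) * exp (I * (⟪ħ⁻¹ • p, r⟫ : ℝ)) := by
      rw [← exp_add, inner_smul_left, inner_smul_left, inner_sub_right]
      congr 1
      simp
      field_simp
      ring
    rw [h2, mulMid_apply ha, mulMid_apply hb]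
    ring
  have hmid : (1 / 2 : ℝ) • (r + r) = r := by module
  rw [weylOp]
  simp_rw [hinner]
  rw [integral_comp_smul_plane (fun q : Plane => planeFourier γ q * exp (I * (⟪q, r⟫ : ℝ))),
    integral_planeFourier_mul_exp, hamiltonOp_apply ha hb, hγ]
  simp only [lineDerivOp_mulMid hb, lineDerivOp_mulMid (hb1 _), LineDeriv.lineDerivOp_add,
    LineDeriv.lineDerivOp_smul, sub_apply, smul_apply, add_apply, mulMid_apply ha,
    mulMid_apply hb, mulMid_apply (hb1 _), mulMid_apply (hb2 _), hmid, smul_eq_mul,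
    Fin.sum_univ_two]
  push_cast
  field_simp
  ring

/-! ### Correlation kernels -/

section Kernel

variable {Ω : Type*} [MeasurableSpace Ω] {P : Measure Ω} {u v : Ω → 𝓢(Plane, ℂ)}

/-- The averaged kernel `(r, Δ) ↦ ⟨u*(r - Δ / 2) v(r + Δ / 2)⟩`. -/
def correlation (hu : IsMemLpFamily 2 P u) (hv : IsMemLpFamily 2 P v) : 𝓢(PhaseSpace, ℂ) :=
  (hu.conjSchwartz.symmetricProduct hv).average

theorem correlation_apply (hu : IsMemLpFamily 2 P u) (hv : IsMemLpFamily 2 P v) (x : PhaseSpace) :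
    correlation hu hv x
      = ∫ ω, conj (u ω (shiftCLM (-(1 / 2)) x)) * v ω (shiftCLM (1 / 2) x) ∂P := rfl

theorem integrable_conj_mul (hu : IsMemLpFamily 2 P u) (hv : IsMemLpFamily 2 P v)
    (r₁ r₂ : Plane) : Integrable (fun ω => conj (u ω r₁) * v ω r₂) P := by
  -- Midpoint and difference invert the map sending (r, Δ) to the pair r ∓ Δ/2.
  have h := (hu.conjSchwartz.symmetricProduct hv).integrable ((1 / 2 : ℝ) • (r₁ + r₂), r₂ - r₁)
  have h1 : shiftCLM (-(1 / 2)) ((1 / 2 : ℝ) • (r₁ + r₂), r₂ - r₁) = r₁ := by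
    simp only [shiftCLM_apply]; module
  have h2 : shiftCLM (1 / 2) ((1 / 2 : ℝ) • (r₁ + r₂), r₂ - r₁) = r₂ := by
    simp only [shiftCLM_apply]; module
  simpa only [symmetricProduct_apply, h1, h2, conjSchwartz_apply] using h

theorem lineDerivOp_correlation (hu : IsMemLpFamily 2 P u) (hv : IsMemLpFamily 2 P v)
    (j : Fin 2) :
    ∂_{rightDir j} (correlation hu hv) = correlation hu (hv.lineDerivOp (basisVec j)) := by
  rw [correlation, IsMemLpFamily.lineDerivOp_average]
  ext x
  simp only [correlation, IsMemLpFamily.average_apply, rightDir, lineDerivOp_symmetricProduct]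

theorem IsMemLpFamily.hamiltonOp {ħ : ℝ} {a b : Plane → ℂ} (ha : a.HasTemperateGrowth)
    (hb : b.HasTemperateGrowth) (hu : IsMemLpFamily 2 P u) :
    IsMemLpFamily 2 P fun ω => hamiltonOp ħ a b (u ω) :=
  hu.map ((WignerOptics.hamiltonOp ħ a b).restrictScalars ℝ) fun x => by
    simp only [ContinuousLinearMap.coe_restrictScalars', hamiltonOp_apply ha hb]
    have h0 := hu.measurable x
    have h1 := fun j => hu.measurable_lineDerivOp (basisVec j) x
    have h2 := fun j => (hu.lineDerivOp (basisVec j)).measurable_lineDerivOp (basisVec j) x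
    fun_prop

/-- The operator is linear with deterministic coefficients and touches only the point r + Δ/2, so it
passes through the average onto the unconjugated field. -/
theorem hamiltonKernel_correlation {ħ : ℝ} {a b : Plane → ℂ} (ha : a.HasTemperateGrowth)
    (hb : b.HasTemperateGrowth) (hu : IsMemLpFamily 2 P u) (hv : IsMemLpFamily 2 P v) :
    hamiltonKernel ħ a b (correlation hu hv)
      = correlation hu (hv.hamiltonOp (ħ := ħ) ha hb) := by
  have hb1 := hasTemperateGrowth_pderiv hb
  have hb2 := fun j => hasTemperateGrowth_pderiv (hb1 j) j
  ext x
  simp only [hamiltonKernel, lineDerivOp_correlation, sub_apply, smul_apply, sum_apply, add_apply,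
    mulShift_apply ha, mulShift_apply hb, mulShift_apply (hb1 _), mulShift_apply (hb2 _),
    correlation_apply, hamiltonOp_apply ha hb, smul_eq_mul]
  set r₁ := shiftCLM (-(1 / 2)) x
  set r₂ := shiftCLM (1 / 2) x
  have i0 := integrable_conj_mul hu hv r₁ r₂
  have i1 := fun j => integrable_conj_mul hu (hv.lineDerivOp (basisVec j)) r₁ r₂
  have i2 := fun j => integrable_conj_mul hu
    ((hv.lineDerivOp (basisVec j)).lineDerivOp (basisVec j)) r₁ r₂
  have hterm : ∀ j : Fin 2, ∀ ω, b r₂ * (conj (u ω r₁) * (∂_{basisVec j} (∂_{basisVec j} (v ω))) r₂)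
      + pderiv j b r₂ * (conj (u ω r₁) * (∂_{basisVec j} (v ω)) r₂)
      + 1 / 4 * (pderiv j (pderiv j b) r₂ * (conj (u ω r₁) * v ω r₂)) =
      conj (u ω r₁) * (b r₂ * (∂_{basisVec j} (∂_{basisVec j} (v ω))) r₂
        + pderiv j b r₂ * (∂_{basisVec j} (v ω)) r₂
        + 1 / 4 * (pderiv j (pderiv j b) r₂ * v ω r₂)) := fun j ω => by ring
  have hj : ∀ j : Fin 2, Integrable (fun ω =>
      b r₂ * (conj (u ω r₁) * (∂_{basisVec j} (∂_{basisVec j} (v ω))) r₂)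
      + pderiv j b r₂ * (conj (u ω r₁) * (∂_{basisVec j} (v ω)) r₂)
      + 1 / 4 * (pderiv j (pderiv j b) r₂ * (conj (u ω r₁) * v ω r₂))) P := fun j =>
    (((i2 j).const_mul _).add ((i1 j).const_mul _)).add ((i0.const_mul _).const_mul _)
  have hfull : ∀ ω, conj (u ω r₁) * (a r₂ * v ω r₂ - (ħ : ℂ) ^ 2 * ∑ j : Fin 2,
      (b r₂ * (∂_{basisVec j} (∂_{basisVec j} (v ω))) r₂ + pderiv j b r₂ * (∂_{basisVec j} (v ω)) r₂
        + 1 / 4 * (pderiv j (pderiv j b) r₂ * v ω r₂)))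
      = a r₂ * (conj (u ω r₁) * v ω r₂) - (ħ : ℂ) ^ 2 * ∑ j : Fin 2,
      (b r₂ * (conj (u ω r₁) * (∂_{basisVec j} (∂_{basisVec j} (v ω))) r₂)
      + pderiv j b r₂ * (conj (u ω r₁) * (∂_{basisVec j} (v ω)) r₂)
      + 1 / 4 * (pderiv j (pderiv j b) r₂ * (conj (u ω r₁) * v ω r₂))) := fun ω => by
    simp only [hterm, ← Finset.mul_sum]
    ring
  simp_rw [hfull]
  rw [integral_sub (i0.const_mul _) ((integrable_finsetSum _ fun j _ => hj j).const_mul _),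
    integral_const_mul, integral_const_mul, integral_finsetSum _ fun j _ => hj j]
  congr 2
  refine Finset.sum_congr rfl fun j _ => ?_
  rw [integral_add (((i2 j).const_mul _).fun_add ((i1 j).const_mul _))
    ((i0.const_mul _).const_mul _), integral_add ((i2 j).const_mul _) ((i1 j).const_mul _)]
  simp only [integral_const_mul]

end Kernel

/-! ### Symmetry under complex conjugation -/

theorem conj_scaledWigner {K L : 𝓢(PhaseSpace, ℂ)} (h : ∀ r y, L (r, y) = conj (K (r, -y)))
    (ħ : ℝ) (x : PhaseSpace) : conj (scaledWigner ħ K x) = scaledWigner ħ L x := by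
  rw [scaledWigner, scaledWigner, map_mul, conj_ofReal, planeFourier_apply, planeFourier_apply,
    ← integral_conj, ← integral_neg_eq_self]
  congr 2
  ext y
  rw [map_mul, slice_apply, slice_apply, h, ← exp_conj]
  simp

theorem phaseFourier_neg {B : PhaseSpace → ℂ} (hB : ∀ x, conj (B x) = B x) (ξ : PhaseSpace) :
    phaseFourier B (-ξ) = conj (phaseFourier B ξ) := by
  rw [phaseFourier, phaseFourier, map_mul, conj_ofReal, ← integral_conj]
  congr 2
  ext x
  rw [map_mul, hB, planeWave, planeWave, ← exp_conj]
  congr 2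
  simp
  ring

theorem integral_comp_neg_phaseSpace (f : PhaseSpace → ℂ) : ∫ ξ, f (-ξ) = ∫ ξ, f ξ := by
  have h := Measure.integral_comp_smul ((volume : Measure Plane).prod volume) f (-1)
  simpa [← Measure.volume_eq_prod] using h

/-- Replacing ξ by -ξ together with τ by -τ leaves the translation unchanged and conjugates the
plane wave; reality of B conjugates its Fourier coefficient. -/
theorem expPoisson_neg {A B : PhaseSpace → ℂ} (hA : ∀ x, conj (A x) = A x)
    (hB : ∀ x, conj (B x) = B x) (τ : ℝ) (x : PhaseSpace) :
    expPoisson (-τ) A B x = conj (expPoisson τ A B x) := by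
  rw [expPoisson, expPoisson, ← integral_conj, ← integral_comp_neg_phaseSpace]
  congr 1
  ext ξ
  rw [expPoissonIntegrand, expPoissonIntegrand, phaseFourier_neg hB, map_mul, map_mul, hA]
  congr 2
  · simp [poissonShift]
  · rw [planeWave, planeWave, ← exp_conj]
    congr 1
    simp
    ring

/-! ### The Moyal bracket with a quadratic symbol -/

/-- A phase space function of the form `a(r) + |p|² b(r)`. -/
def quadraticSymbol (a b : Plane → ℝ) (x : PhaseSpace) : ℂ :=
  (a x.1 : ℂ) + ((‖x.2‖ ^ 2 : ℝ) : ℂ) * (b x.1 : ℂ)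

theorem hasTemperateGrowth_ofReal_comp {a : Plane → ℝ} (ha : a.HasTemperateGrowth) :
    (fun r => (a r : ℂ)).HasTemperateGrowth :=
  Function.Complex.hasTemperateGrowth_ofReal.comp ha

theorem moyalDefined_scaledWigner {ħ : ℝ} (hħ : ħ ≠ 0) (K : 𝓢(PhaseSpace, ℂ))
    {A : PhaseSpace → ℂ} (hA : A.HasTemperateGrowth) (x : PhaseSpace) :
    MoyalDefined ħ A (scaledWigner ħ K) x where
  integrable := integrable_scaledWigner hħ K
  inversion y := by
    -- Fourier inversion is the product formula for the constant symbol 1, on which every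
    -- translation acts trivially.
    have h1 : (fun _ : Plane => (1 : ℂ)).HasTemperateGrowth := .const 1
    have h0 : (fun _ : Plane => (0 : ℂ)).HasTemperateGrowth := .const 0
    have hi := integrable_expPoissonIntegrand hħ K (ħ / 2) (hasTemperateGrowth_quadratic h1 h0) y
    have he := expPoisson_scaledWigner hħ K h1 h0 y
    have hm : moyalKernel ħ (fun _ => 1) (fun _ => 0) y.2 K = K := by
      ext z
      simp [moyalKernel, mulShift_apply h1, mulShift_apply h0]
    have hfun : expPoissonIntegrand (ħ / 2) (fun x : PhaseSpace => (fun _ : Plane => (1 : ℂ)) x.1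
        + ((‖x.2‖ ^ 2 : ℝ) : ℂ) * (fun _ : Plane => (0 : ℂ)) x.1) (scaledWigner ħ K) y
        = fun ξ => phaseFourier (scaledWigner ħ K) ξ * planeWave ξ y := by
      funext ξ
      simp [expPoissonIntegrand]
    rw [hm, expPoisson, hfun] at he
    rw [hfun] at hi
    exact ⟨hi, he.symm⟩
  integrable_pos := integrable_expPoissonIntegrand hħ K _ hA x
  integrable_neg := integrable_expPoissonIntegrand hħ K _ hA x

theorem moyalBracket_scaledWigner {ħ : ℝ} (hħ : ħ ≠ 0) {K : 𝓢(PhaseSpace, ℂ)}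
    (hK : ∀ r y, K (r, y) = conj (K (r, -y))) {a b : Plane → ℝ} (ha : a.HasTemperateGrowth)
    (hb : b.HasTemperateGrowth) (x : PhaseSpace) :
    moyalBracket ħ (quadraticSymbol a b) (scaledWigner ħ K) x =
      (I * ħ)⁻¹ * (scaledWigner ħ (hamiltonKernel ħ (fun r => a r) (fun r => b r) K) x
        - conj (scaledWigner ħ (hamiltonKernel ħ (fun r => a r) (fun r => b r) K) x)) := by
  have ha' := hasTemperateGrowth_ofReal_comp ha
  have hb' := hasTemperateGrowth_ofReal_comp hb
  have hE : expPoisson (ħ / 2) (quadraticSymbol a b) (scaledWigner ħ K) x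
      = scaledWigner ħ (hamiltonKernel ħ (fun r => a r) (fun r => b r) K) x :=
    (expPoisson_scaledWigner hħ K ha' hb' x).trans (scaledWigner_moyalKernel hħ _ hb' K x)
  have hħ' : (ħ : ℂ) ≠ 0 := by exact_mod_cast hħ
  rw [moyalBracket, sinPoisson, expPoisson_neg (fun y => by simp [quadraticSymbol])
    (conj_scaledWigner hK ħ), hE]
  push_cast
  field_simp

/-! ### Differentiation of the Wigner function along the optical axis -/

section Propagation

variable {Ω : Type*} [MeasurableSpace Ω] {P : Measure Ω} {Z : Set ℝ} {U V : Ω → ℝ → 𝓢(Plane, ℂ)}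

theorem IsRegularEnsemble.isMemLpFamily (hU : IsRegularEnsemble P Z U) {z : ℝ} (hz : z ∈ Z) :
    IsMemLpFamily 2 P fun ω => U ω z where
  measurable := hU.measurable z hz
  seminorm_bound k l := by
    obtain ⟨ε, hε, g, hg, h⟩ := hU.seminorm_bound k l z hz
    exact ⟨g, hg, h.mono fun ω hω => hω z hz (by simpa using hε)⟩

theorem IsRegularEnsemble.map (hU : IsRegularEnsemble P Z U) (T : 𝓢(Plane, ℂ) →L[ℝ] 𝓢(Plane, ℂ))
    (hT : ∀ z ∈ Z, ∀ r, Measurable fun ω => T (U ω z) r) :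
    IsRegularEnsemble P Z fun ω z => T (U ω z) where
  measurable := hT
  seminorm_bound k l z₀ hz₀ := by
    obtain ⟨s, C, hC, hle⟩ := exists_seminorm_le_sum T k l
    choose ε hε g hg hgle using fun k l => hU.seminorm_bound k l z₀ hz₀
    -- A common radius below the finitely many radii that are needed, also when there are none.
    have hev : ∀ᶠ e in nhdsWithin (0 : ℝ) (Set.Ioi 0), (∀ i ∈ s, e < ε i.1 i.2) ∧ 0 < e :=
      ((Filter.eventually_all_finset s).2 fun i _ =>
        nhdsWithin_le_nhds (eventually_lt_nhds (hε i.1 i.2))).and self_mem_nhdsWithin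
    obtain ⟨e, he, hpos⟩ := hev.exists
    have hsum : MemLp (fun ω => ∑ i ∈ s, g i.1 i.2 ω) 2 P :=
      memLp_finsetSum s fun i _ => hg i.1 i.2
    refine ⟨e, hpos, fun ω => C * ∑ i ∈ s, g i.1 i.2 ω, hsum.const_mul C, ?_⟩
    filter_upwards [ae_all_iff.2 fun k => ae_all_iff.2 fun l => hgle k l] with ω hω z hz hlt
    exact (hle _).trans (mul_le_mul_of_nonneg_left
      (Finset.sum_le_sum fun i hi => hω i.1 i.2 z hz (hlt.trans (he i hi))) hC)

theorem IsRegularEnsemble.exists_pointwise_bound (hU : IsRegularEnsemble P Z U) {z₀ : ℝ}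
    (hz₀ : z₀ ∈ Z) : ∃ ε > 0, ∃ G : Ω → ℝ, MemLp G 2 P ∧ ∀ᵐ ω ∂P, ∀ z ∈ Z, |z - z₀| < ε →
      ∀ r, (1 + ‖r‖) ^ 3 * ‖U ω z r‖ ≤ G ω := by
  obtain ⟨ε, hε, g, hg, h⟩ := hU.seminorm_bound 0 0 z₀ hz₀
  obtain ⟨ε', hε', g', hg', h'⟩ := hU.seminorm_bound 3 0 z₀ hz₀
  refine ⟨min ε ε', lt_min hε hε', fun ω => 2 ^ 3 * (g ω + g' ω), (hg.add hg').const_mul _, ?_⟩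
  filter_upwards [h, h'] with ω hω hω' z hz hlt r
  have e1 := ((U ω z).norm_le_seminorm ℝ r).trans (hω z hz (hlt.trans_le (min_le_left _ _)))
  have e2 := ((U ω z).norm_pow_mul_le_seminorm ℝ 3 r).trans
    (hω' z hz (hlt.trans_le (min_le_right _ _)))
  calc (1 + ‖r‖) ^ 3 * ‖U ω z r‖ ≤ 2 ^ 3 * (1 + ‖r‖ ^ 3) * ‖U ω z r‖ := by
        gcongr
        exact one_add_pow_le (norm_nonneg _) 3
    _ = 2 ^ 3 * (‖U ω z r‖ + ‖r‖ ^ 3 * ‖U ω z r‖) := by ring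
    _ ≤ _ := by gcongr

/-- Since 1 + |r₂ - r₁| ≤ (1 + |r₁|)(1 + |r₂|), decay of the fields becomes decay in the separation
alone, which dominates the Δ-integral. -/
theorem norm_conj_mul_le {r₁ r₂ : Plane} {u v : ℂ} {G G' : ℝ} (hu : (1 + ‖r₁‖) ^ 3 * ‖u‖ ≤ G)
    (hv : (1 + ‖r₂‖) ^ 3 * ‖v‖ ≤ G') :
    ‖conj u * v‖ ≤ G * G' * ((1 + ‖r₂ - r₁‖) ^ 3)⁻¹ := by
  have hG : 0 ≤ G := le_trans (by positivity) hu
  have hd : 1 + ‖r₂ - r₁‖ ≤ (1 + ‖r₁‖) * (1 + ‖r₂‖) := by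
    have := norm_sub_le r₂ r₁
    nlinarith [norm_nonneg r₁, norm_nonneg r₂, mul_nonneg (norm_nonneg r₁) (norm_nonneg r₂)]
  rw [← div_eq_mul_inv, le_div_iff₀ (by positivity), norm_mul, RCLike.norm_conj]
  calc ‖u‖ * ‖v‖ * (1 + ‖r₂ - r₁‖) ^ 3 ≤ ‖u‖ * ‖v‖ * ((1 + ‖r₁‖) * (1 + ‖r₂‖)) ^ 3 := by gcongr
    _ = ((1 + ‖r₁‖) ^ 3 * ‖u‖) * ((1 + ‖r₂‖) ^ 3 * ‖v‖) := by rw [mul_pow]; ac_rfl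
    _ ≤ G * G' := by gcongr

/-- A common bound for the derivative in `z` of `conj (U r₁) * U r₂` near `z₀`. -/
theorem exists_correlation_deriv_bound (hZ : IsOpen Z) (hU : IsRegularEnsemble P Z U)
    (hV : IsRegularEnsemble P Z V) {z₀ : ℝ} (hz₀ : z₀ ∈ Z) :
    ∃ s ∈ nhds z₀, s ⊆ Z ∧ ∃ G : Ω → ℝ, Integrable G P ∧ ∀ᵐ ω ∂P, ∀ z ∈ s, ∀ r₁ r₂,
      ‖conj (V ω z r₁) * U ω z r₂ + conj (U ω z r₁) * V ω z r₂‖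
        ≤ G ω * ((1 + ‖r₂ - r₁‖) ^ 3)⁻¹ := by
  obtain ⟨ε, hε, g, hg, h⟩ := hU.exists_pointwise_bound hz₀
  obtain ⟨ε', hε', g', hg', h'⟩ := hV.exists_pointwise_bound hz₀
  refine ⟨Metric.ball z₀ (min ε ε') ∩ Z,
    Filter.inter_mem (Metric.ball_mem_nhds _ (lt_min hε hε')) (hZ.mem_nhds hz₀),
    Set.inter_subset_right, fun ω => g' ω * g ω + g ω * g' ω,
    (hg'.integrable_mul hg).add (hg.integrable_mul hg'), ?_⟩
  filter_upwards [h, h'] with ω hω hω' z hz r₁ r₂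
  have hlt : |z - z₀| < min ε ε' := by simpa [Real.dist_eq] using hz.1
  have b1 := hω z hz.2 (hlt.trans_le (min_le_left _ _))
  have b2 := hω' z hz.2 (hlt.trans_le (min_le_right _ _))
  rw [add_mul]
  exact (norm_add_le _ _).trans
    (add_le_add (norm_conj_mul_le (b2 r₁) (b1 r₂)) (norm_conj_mul_le (b1 r₁) (b2 r₂)))

theorem hasDerivAt_csd (hZ : IsOpen Z) (hU : IsRegularEnsemble P Z U)
    (hV : IsRegularEnsemble P Z V)
    (hUV : ∀ᵐ ω ∂P, ∀ z ∈ Z, ∀ r, HasDerivAt (fun ζ => U ω ζ r) (V ω z r) z) {z : ℝ} (hz : z ∈ Z)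
    (r₁ r₂ : Plane) :
    HasDerivAt (fun ζ => csd P (fun ω => U ω ζ) r₁ r₂)
      (∫ ω, (conj (V ω z r₁) * U ω z r₂ + conj (U ω z r₁) * V ω z r₂) ∂P) z := by
  obtain ⟨s, hs, hsZ, G, hG, hle⟩ := exists_correlation_deriv_bound hZ hU hV hz
  have hfam := fun ζ (hζ : ζ ∈ Z) => hU.isMemLpFamily hζ
  refine (hasDerivAt_integral_of_dominated_loc_of_deriv_le hs
    (F := fun ζ ω => conj (U ω ζ r₁) * U ω ζ r₂)
    (F' := fun ζ ω => conj (V ω ζ r₁) * U ω ζ r₂ + conj (U ω ζ r₁) * V ω ζ r₂)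
    (bound := fun ω => G ω * ((1 + ‖r₂ - r₁‖) ^ 3)⁻¹) ?_ ?_ ?_ ?_ (hG.mul_const _) ?_).2
  · filter_upwards [hZ.mem_nhds hz] with ζ hζ
    exact (integrable_conj_mul (hfam ζ hζ) (hfam ζ hζ) r₁ r₂).aestronglyMeasurable
  · exact integrable_conj_mul (hfam z hz) (hfam z hz) r₁ r₂
  · exact ((integrable_conj_mul (hV.isMemLpFamily hz) (hfam z hz) r₁ r₂).add
      (integrable_conj_mul (hfam z hz) (hV.isMemLpFamily hz) r₁ r₂)).aestronglyMeasurable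
  · filter_upwards [hle] with ω hω ζ hζ
    exact hω ζ hζ r₁ r₂
  · filter_upwards [hUV] with ω hω ζ hζ
    have h1 : HasDerivAt (fun ζ => conj (U ω ζ r₁)) (conj (V ω ζ r₁)) ζ :=
      (conjCLE : ℂ →L[ℝ] ℂ).hasFDerivAt.comp_hasDerivAt ζ (hω ζ (hsZ hζ) r₁)
    exact h1.mul (hω ζ (hsZ hζ) r₂)

/-! ### The Wigner function as a Fourier transform of the correlation kernel, and its derivative -/

theorem csd_eq_correlation (hU : IsRegularEnsemble P Z U) {z : ℝ} (hz : z ∈ Z) (r y : Plane) :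
    csd P (fun ω => U ω z) (r - (1 / 2 : ℝ) • y) (r + (1 / 2 : ℝ) • y)
      = correlation (hU.isMemLpFamily hz) (hU.isMemLpFamily hz) (r, y) := by
  have h : r - (1 / 2 : ℝ) • y = shiftCLM (-(1 / 2)) (r, y) := by
    simp only [shiftCLM_apply]
    module
  rw [csd, h, correlation_apply]
  rfl

theorem wignerIntegrand_csd (hU : IsRegularEnsemble P Z U) {z : ℝ} (hz : z ∈ Z) (r q : Plane) :
    wignerIntegrand (csd P fun ω => U ω z) r q = fun y =>
      slice (correlation (hU.isMemLpFamily hz) (hU.isMemLpFamily hz)) r y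
        * exp (-I * (⟪q, y⟫ : ℝ)) := by
  funext y
  rw [wignerIntegrand, csd_eq_correlation hU hz, slice_apply]

theorem wigner_csd (hU : IsRegularEnsemble P Z U) {z : ℝ} (hz : z ∈ Z) (r q : Plane) :
    wigner (csd P fun ω => U ω z) r q = (1 / (2 * Real.pi) ^ 2 : ℝ) *
      planeFourier (slice (correlation (hU.isMemLpFamily hz) (hU.isMemLpFamily hz)) r) q := by
  rw [wigner, wignerIntegrand_csd hU hz, planeFourier_apply]

theorem hasDerivAt_wigner (hZ : IsOpen Z) (hU : IsRegularEnsemble P Z U)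
    (hV : IsRegularEnsemble P Z V)
    (hUV : ∀ᵐ ω ∂P, ∀ z ∈ Z, ∀ r, HasDerivAt (fun ζ => U ω ζ r) (V ω z r) z) {z : ℝ} (hz : z ∈ Z)
    (r q : Plane) :
    HasDerivAt (fun ζ => wigner (csd P fun ω => U ω ζ) r q) ((1 / (2 * Real.pi) ^ 2 : ℝ) *
      planeFourier (slice (correlation (hV.isMemLpFamily hz) (hU.isMemLpFamily hz)
        + correlation (hU.isMemLpFamily hz) (hV.isMemLpFamily hz)) r) q) z := by
  obtain ⟨s, hs, hsZ, G, hG, hle⟩ := exists_correlation_deriv_bound hZ hU hV hz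
  set D : ℝ → Plane → ℂ := fun ζ y => ∫ ω, (conj (V ω ζ (r - (1 / 2 : ℝ) • y)) *
    U ω ζ (r + (1 / 2 : ℝ) • y) + conj (U ω ζ (r - (1 / 2 : ℝ) • y)) *
      V ω ζ (r + (1 / 2 : ℝ) • y)) ∂P with hD
  have hDz : D z = fun y => slice (correlation (hV.isMemLpFamily hz) (hU.isMemLpFamily hz)
        + correlation (hU.isMemLpFamily hz) (hV.isMemLpFamily hz)) r y := by
    funext y
    have h : r - (1 / 2 : ℝ) • y = shiftCLM (-(1 / 2)) (r, y) := by
      simp only [shiftCLM_apply]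
      module
    rw [slice_apply, add_apply, correlation_apply, correlation_apply, hD]
    simp only [h]
    exact integral_add (integrable_conj_mul (hV.isMemLpFamily hz) (hU.isMemLpFamily hz) _ _)
      (integrable_conj_mul (hU.isMemLpFamily hz) (hV.isMemLpFamily hz) _ _)
  rw [planeFourier_apply]
  refine HasDerivAt.const_mul _ ?_
  have hmain := hasDerivAt_integral_of_dominated_loc_of_deriv_le (μ := (volume : Measure Plane)) hs
    (F := fun ζ y => wignerIntegrand (csd P fun ω => U ω ζ) r q y)
    (F' := fun ζ y => D ζ y * exp (-I * (⟪q, y⟫ : ℝ)))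
    (bound := fun y => (∫ ω, G ω ∂P) * ((1 + ‖y‖) ^ 3)⁻¹) ?_ ?_ ?_ ?_
    (integrable_one_add_norm_plane.const_mul _) ?_
  · have h2 := hmain.2
    rw [hDz] at h2
    exact h2
  · filter_upwards [hZ.mem_nhds hz] with ζ hζ
    rw [wignerIntegrand_csd hU hζ]
    exact (integrable_mul_exp_neg _ q).aestronglyMeasurable
  · rw [wignerIntegrand_csd hU hz]
    exact integrable_mul_exp_neg _ q
  · simp only [hDz]
    exact (integrable_mul_exp_neg _ q).aestronglyMeasurable
  · refine Filter.Eventually.of_forall fun y ζ hζ => ?_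
    rw [norm_mul, norm_exp_neg_I_mul_ofReal, mul_one, ← integral_mul_const]
    refine norm_integral_le_of_norm_le (hG.mul_const _) ?_
    filter_upwards [hle] with ω hω
    have h := hω ζ hζ (r - (1 / 2 : ℝ) • y) (r + (1 / 2 : ℝ) • y)
    have hy : r + (1 / 2 : ℝ) • y - (r - (1 / 2 : ℝ) • y) = y := by module
    rwa [hy] at h
  · refine Filter.Eventually.of_forall fun y ζ hζ => ?_
    exact (hasDerivAt_csd hZ hU hV hUV (hsZ hζ) _ _).mul_const _

theorem correlation_conj_symm {u v : Ω → 𝓢(Plane, ℂ)} (hu : IsMemLpFamily 2 P u)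
    (hv : IsMemLpFamily 2 P v) (r y : Plane) :
    correlation hv hu (r, y) = conj (correlation hu hv (r, -y)) := by
  rw [correlation_apply, correlation_apply, ← integral_conj]
  congr 1
  ext ω
  simp only [map_mul, conj_conj, shiftCLM_apply, smul_neg, neg_smul, neg_neg]
  ring

/-- A random field whose realizations solve the Schrödinger equation with the quantization of
`a(r) + |p|² b(r)` has a Wigner function that solves the Wigner–Moyal equation. -/
theorem solvesWignerMoyal_of_hamiltonOp {lam : ℝ} (hlam : 0 < lam) (hZ : IsOpen Z)
    (hU : IsRegularEnsemble P Z U) {a b : Plane → ℝ} (ha : a.HasTemperateGrowth)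
    (hb : b.HasTemperateGrowth)
    (hsol : ∀ᵐ ω ∂P, ∀ z ∈ Z, ∀ r, HasDerivAt (fun ζ => U ω ζ r)
      ((I * reducedWavelength lam)⁻¹ * hamiltonOp (reducedWavelength lam) (fun r => a r)
        (fun r => b r) (U ω z) r) z) :
    SolvesWignerMoyal (reducedWavelength lam) (quadraticSymbol a b) Z
      (opticalWigner P lam 1 U) := by
  have ha' := hasTemperateGrowth_ofReal_comp ha
  have hb' := hasTemperateGrowth_ofReal_comp hb
  have hk : wavenumber lam = (reducedWavelength lam)⁻¹ := by
    rw [wavenumber, reducedWavelength, inv_div]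
  have hħ : reducedWavelength lam ≠ 0 := by
    rw [reducedWavelength]
    positivity
  set ħ := reducedWavelength lam
  have hop := fun z (hz : z ∈ Z) => (hU.isMemLpFamily hz).hamiltonOp (ħ := ħ) ha' hb'
  -- The z-derivative of the field is (iħ)⁻¹ĤU, again a regular ensemble because Ĥ is continuous on
  -- Schwartz space.
  have hV : IsRegularEnsemble P Z fun ω z =>
      (I * (ħ : ℂ))⁻¹ • hamiltonOp ħ (fun r => a r) (fun r => b r) (U ω z) :=
    hU.map (((I * (ħ : ℂ))⁻¹ • hamiltonOp ħ (fun r => a r) (fun r => b r)).restrictScalars ℝ)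
      fun z hz r => ((hop z hz).measurable r).const_mul _
  intro z hz x
  have hw : opticalWigner P lam 1 U z
      = scaledWigner ħ (correlation (hU.isMemLpFamily hz) (hU.isMemLpFamily hz)) := by
    funext y
    rw [opticalWigner, wigner_csd hU hz, scaledWigner, one_mul, hk]
  rw [hw]
  refine ⟨moyalDefined_scaledWigner hħ _ (hasTemperateGrowth_quadratic ha' hb') x, ?_⟩
  have hder := hasDerivAt_wigner hZ hU hV hsol hz x.1 ((1 * wavenumber lam) • x.2)
  refine hder.congr_deriv ?_
  rw [moyalBracket_scaledWigner hħ (correlation_conj_symm _ _) ha hb,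
    hamiltonKernel_correlation ha' hb']
  set S := correlation (hU.isMemLpFamily hz) (hop z hz)
  have hS : correlation (hU.isMemLpFamily hz) (hV.isMemLpFamily hz) = (I * (ħ : ℂ))⁻¹ • S := by
    ext y
    rw [smul_apply, correlation_apply, correlation_apply, smul_eq_mul, ← integral_const_mul]
    congr 1
    ext ω
    rw [smul_apply, smul_eq_mul]
    ring
  have h1 : (1 / (2 * Real.pi) ^ 2 : ℝ) * planeFourier (slice
      (correlation (hV.isMemLpFamily hz) (hU.isMemLpFamily hz)
        + correlation (hU.isMemLpFamily hz) (hV.isMemLpFamily hz)) x.1)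
        ((1 * wavenumber lam) • x.2)
      = scaledWigner ħ (correlation (hV.isMemLpFamily hz) (hU.isMemLpFamily hz)) x
        + scaledWigner ħ (correlation (hU.isMemLpFamily hz) (hV.isMemLpFamily hz)) x := by
    rw [one_mul, hk]
    exact (congrArg _ ((sliceFourier x.1 (ħ⁻¹ • x.2)).map_add _ _)).trans (mul_add _ _ _)
  have h2 : scaledWigner ħ ((I * (ħ : ℂ))⁻¹ • S) x = (I * (ħ : ℂ))⁻¹ * scaledWigner ħ S x :=
    (congrArg _ ((sliceFourier x.1 (ħ⁻¹ • x.2)).map_smul _ _)).trans (mul_left_comm _ _ _)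
  -- The contribution with the derivative on the conjugated field is the conjugate of the other one,
  -- as in the Moyal bracket.
  rw [h1, ← conj_scaledWigner (correlation_conj_symm (hU.isMemLpFamily hz) (hV.isMemLpFamily hz)),
    hS, h2, map_mul, map_inv₀, map_mul, conj_I, conj_ofReal]
  have : (ħ : ℂ) ≠ 0 := by exact_mod_cast hħ
  field_simp
  ring

end Propagation

/-! ### The two wave equations -/

section Equations

variable {Ω : Type*} [MeasurableSpace Ω] {P : Measure Ω} {Z : Set ℝ} {U : Ω → ℝ → 𝓢(Plane, ℂ)}

/-- The substitution Δ → -Δ trades the sign of the momentum for an exchange of the two points, which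
is conjugation of the field. -/
theorem opticalWigner_neg_one (P : Measure Ω) (lam : ℝ) (U : Ω → ℝ → 𝓢(Plane, ℂ)) :
    opticalWigner P lam (-1) U = opticalWigner P lam 1 fun ω z => conjSchwartz (U ω z) := by
  funext z x
  rw [opticalWigner, opticalWigner, wigner, wigner, ← integral_neg_eq_self]
  congr 2
  ext y
  have h : csd P (fun ω => conjSchwartz (U ω z)) (x.1 - (1 / 2 : ℝ) • y) (x.1 + (1 / 2 : ℝ) • y)
      = csd P (fun ω => U ω z) (x.1 + (1 / 2 : ℝ) • y) (x.1 - (1 / 2 : ℝ) • y) := by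
    simp only [csd, conjSchwartz_apply, conj_conj]
    congr 1
    ext ω
    ring
  rw [wignerIntegrand, wignerIntegrand, h, smul_neg, sub_neg_eq_add, ← sub_eq_add_neg]
  simp

theorem lineDerivOp_conjSchwartz (v : Plane) (u : 𝓢(Plane, ℂ)) :
    ∂_{v} (conjSchwartz u) = conjSchwartz (∂_{v} u) := by
  ext r
  have h : HasFDerivAt (conjSchwartz u) ((conjCLE : ℂ →L[ℝ] ℂ).comp (fderiv ℝ u r)) r :=
    (conjCLE : ℂ →L[ℝ] ℂ).hasFDerivAt.comp r (u.hasFDerivAt r)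
  rw [SchwartzMap.lineDerivOp_apply_eq_fderiv, h.fderiv, conjSchwartz_apply,
    SchwartzMap.lineDerivOp_apply_eq_fderiv]
  rfl

theorem IsRegularEnsemble.conjSchwartz (hU : IsRegularEnsemble P Z U) :
    IsRegularEnsemble P Z fun ω z => conjSchwartz (U ω z) :=
  hU.map _ fun _ hz r => (hU.isMemLpFamily hz).conjSchwartz.measurable r

theorem laplacian_schwartz_apply (u : 𝓢(Plane, ℂ)) (r : Plane) :
    Laplacian.laplacian (fun y : Plane => u y) r
      = ∑ j : Fin 2, (∂_{basisVec j} (∂_{basisVec j} u)) r := by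
  have h := SchwartzMap.laplacian_apply u r
  rw [SchwartzMap.laplacian_eq_sum (EuclideanSpace.basisFun (Fin 2) ℝ), sum_apply] at h
  simpa only [EuclideanSpace.basisFun_apply, ← basisVec.eq_1] using h.symm

/-- The position dependent part of the paraxial Hamiltonian. -/
def paraxialPotential (n : Plane → ℝ) (r : Plane) : ℝ := -(n r ^ 2 - 1) / 2

theorem hasTemperateGrowth_paraxialPotential {n : Plane → ℝ} (hn : n.HasTemperateGrowth) :
    (paraxialPotential n).HasTemperateGrowth := by
  have h : paraxialPotential n = fun r => (-(1 / 2) : ℝ) * (n r ^ 2 - 1) := by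
    funext r
    rw [paraxialPotential]
    ring
  rw [h]
  fun_prop

theorem quadraticSymbol_paraxial (n : Plane → ℝ) :
    quadraticSymbol (paraxialPotential n) (fun _ => 1 / 2) = paraxialHamiltonian n := by
  funext x
  rw [quadraticSymbol, paraxialHamiltonian, paraxialPotential]
  push_cast
  ring

theorem quadraticSymbol_optical (n : Plane → ℝ) :
    quadraticSymbol (fun r => -n r) (fun r => (1 / 2) * (n r)⁻¹) = opticalHamiltonian n := by
  funext x
  have h : ‖x.2‖ ^ 2 / (2 * n x.1) = ‖x.2‖ ^ 2 * ((1 / 2) * (n x.1)⁻¹) := by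
    rw [div_eq_mul_inv, mul_inv, one_div]
  rw [quadraticSymbol, opticalHamiltonian, h]
  push_cast
  ring

theorem hamiltonOp_paraxial {n : Plane → ℝ} (hn : n.HasTemperateGrowth) (ħ : ℝ) (u : 𝓢(Plane, ℂ))
    (r : Plane) :
    hamiltonOp ħ (fun r => paraxialPotential n r) (fun _ => ((1 / 2 : ℝ) : ℂ)) u r
      = -(1 / 2) * (((n r : ℂ) ^ 2 - 1) * u r
        + (ħ : ℂ) ^ 2 * ∑ j : Fin 2, (∂_{basisVec j} (∂_{basisVec j} u)) r) := by
  have h0 : ∀ j, pderiv j (fun _ : Plane => ((1 / 2 : ℝ) : ℂ)) = fun _ => 0 := fun j => by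
    funext r
    simp [pderiv]
  have h1 : ∀ j, pderiv j (fun _ : Plane => (0 : ℂ)) = fun _ => 0 := fun j => by
    funext r
    simp [pderiv]
  rw [hamiltonOp_apply (hasTemperateGrowth_ofReal_comp (hasTemperateGrowth_paraxialPotential hn))
    (.const _)]
  simp only [h0, h1, paraxialPotential, Fin.sum_univ_two]
  push_cast
  ring

/-- As k = 1/ħ, the right side of the wave equation is -2σk²ĤU, and division by 2ik leaves iħ ∂U/∂z
= -σĤU. -/
theorem SolvesParaxial.hasDerivAt {lam σ : ℝ} (hlam : 0 < lam) {n : Plane → ℝ}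
    (hn : n.HasTemperateGrowth) {u : ℝ → 𝓢(Plane, ℂ)} (hu : SolvesParaxial lam σ n Z u) {z : ℝ}
    (hz : z ∈ Z) (r : Plane) : HasDerivAt (fun ζ => u ζ r)
      (-σ * ((I * reducedWavelength lam)⁻¹ * hamiltonOp (reducedWavelength lam)
        (fun r => paraxialPotential n r) (fun _ => ((1 / 2 : ℝ) : ℂ)) (u z) r)) z := by
  obtain ⟨hd, heq⟩ := hu z hz r
  refine hd.hasDerivAt.congr_deriv ?_
  have hk : wavenumber lam = (reducedWavelength lam)⁻¹ := by
    rw [wavenumber, reducedWavelength, inv_div]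
  have hħ : (reducedWavelength lam : ℂ) ≠ 0 := by
    rw [reducedWavelength]
    exact_mod_cast (by positivity : lam / (2 * Real.pi) ≠ 0)
  rw [laplacian_schwartz_apply, hk] at heq
  rw [hamiltonOp_paraxial hn]
  push_cast at heq
  set ħ : ℂ := (reducedWavelength lam : ℂ)
  field_simp at heq ⊢
  linear_combination heq

theorem solvesWignerMoyal_of_paraxial {lam : ℝ} (hlam : 0 < lam) (hZ : IsOpen Z)
    (hU : IsRegularEnsemble P Z U) {n : Plane → ℝ} (hn : n.HasTemperateGrowth) {σ : ℝ}
    (hσ : σ = 1 ∨ σ = -1) (hsol : ∀ᵐ ω ∂P, SolvesParaxial lam σ n Z (U ω)) :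
    SolvesWignerMoyal (reducedWavelength lam) (paraxialHamiltonian n) Z
      (opticalWigner P lam (-σ) U) := by
  have ha := hasTemperateGrowth_paraxialPotential hn
  rw [← quadraticSymbol_paraxial]
  rcases hσ with rfl | rfl
  · rw [opticalWigner_neg_one]
    refine solvesWignerMoyal_of_hamiltonOp hlam hZ hU.conjSchwartz ha (.const _) ?_
    filter_upwards [hsol] with ω hω z hz r
    -- The paraxial operator has real coefficients and commutes with conjugation, which changes the
    -- sign of i and so absorbs the factor -1.
    have h := (conjCLE : ℂ →L[ℝ] ℂ).hasFDerivAt.comp_hasDerivAt z (hω.hasDerivAt hlam hn hz r)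
    refine h.congr_deriv ?_
    rw [hamiltonOp_paraxial hn, hamiltonOp_paraxial hn]
    simp [lineDerivOp_conjSchwartz]
    exact Or.inl (Or.inl (conj_ofNat 2))
  · rw [neg_neg]
    refine solvesWignerMoyal_of_hamiltonOp hlam hZ hU ha (.const _) ?_
    filter_upwards [hsol] with ω hω z hz r
    simpa using hω.hasDerivAt hlam hn hz r

theorem solvesWignerMoyal_of_schrodinger {lam : ℝ} (hlam : 0 < lam) (hZ : IsOpen Z)
    (hU : IsRegularEnsemble P Z U) {n : Plane → ℝ} (hn : n.HasTemperateGrowth)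
    (hn' : (fun r => (n r)⁻¹).HasTemperateGrowth)
    (hsol : ∀ᵐ ω ∂P, SolvesSchrodinger lam (opticalHamiltonian n) Z (U ω)) :
    SolvesWignerMoyal (reducedWavelength lam) (opticalHamiltonian n) Z
      (opticalWigner P lam 1 U) := by
  have ha : (fun r => -n r).HasTemperateGrowth := hn.neg
  have hb : (fun r => (1 / 2 : ℝ) * (n r)⁻¹).HasTemperateGrowth := by fun_prop
  have hħ : reducedWavelength lam ≠ 0 := by
    rw [reducedWavelength]
    positivity
  rw [← quadraticSymbol_optical]
  refine solvesWignerMoyal_of_hamiltonOp hlam hZ hU ha hb ?_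
  filter_upwards [hsol] with ω hω z hz r
  obtain ⟨hd, heq⟩ := hω z hz r
  refine hd.hasDerivAt.congr_deriv ?_
  rw [← weylOp_quadratic hħ (hasTemperateGrowth_ofReal_comp ha) (hasTemperateGrowth_ofReal_comp hb)]
  rw [← quadraticSymbol_optical] at heq
  have hħ' : (reducedWavelength lam : ℂ) ≠ 0 := by exact_mod_cast hħ
  exact (eq_inv_mul_iff_mul_eq₀ (mul_ne_zero I_ne_zero hħ')).2 heq

end Equations

end WignerOptics

end

/-! ### Convergence of the integrals and the two transport equations -/

open WignerOptics MeasureTheory in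
theorem mainTheorem4 {Ω : Type*} [MeasurableSpace Ω] (P : Measure Ω) [IsProbabilityMeasure P]
    (lam : ℝ) (hlam : 0 < lam) (n : Plane → ℝ) (hn : n.HasTemperateGrowth)
    (Z : Set ℝ) (hZ : IsOpen Z) (U : Ω → ℝ → SchwartzMap Plane ℂ)
    (hU : IsRegularEnsemble P Z U) :
    (∀ z ∈ Z, (∀ r₁ r₂, Integrable (fun ω => starRingEnd ℂ (U ω z r₁) * U ω z r₂) P) ∧
      ∀ r p, Integrable (wignerIntegrand (csd P fun ω => U ω z) r p)) ∧
    (∀ σ : ℝ, σ = 1 ∨ σ = -1 → (∀ᵐ ω ∂P, SolvesParaxial lam σ n Z (U ω)) →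
      SolvesWignerMoyal (reducedWavelength lam) (paraxialHamiltonian n) Z
        (opticalWigner P lam (-σ) U)) ∧
    ((∀ r, 0 < n r) → (fun r => (n r)⁻¹).HasTemperateGrowth →
      (∀ᵐ ω ∂P, SolvesSchrodinger lam (opticalHamiltonian n) Z (U ω)) →
      SolvesWignerMoyal (reducedWavelength lam) (opticalHamiltonian n) Z
        (opticalWigner P lam 1 U)) := by
  refine ⟨fun z hz => ⟨integrable_conj_mul (hU.isMemLpFamily hz) (hU.isMemLpFamily hz),
    fun r p => ?_⟩, fun σ hσ hsol => solvesWignerMoyal_of_paraxial hlam hZ hU hn hσ hsol,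
    fun _ hn' hsol => solvesWignerMoyal_of_schrodinger hlam hZ hU hn hn' hsol⟩
  rw [wignerIntegrand_csd hU hz]
  exact integrable_mul_exp_neg _ p
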